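/- Let $\mathbb{D}$ be the space of càdlàg functions $x:[0,1]\to\mathbb{R}$ (right-continuous with left limits), equipped with the metric $$d^0_{J_1}(x,y)=\inf_{\lambda\in\Lambda}\Big\{\|\lambda\|^0\vee\sup_{s\in[0,1]}|x(s)-y(\lambda(s))|\Big\},\qquad \|\lambda\|^0=\sup_{s<s'}\Big|\log\frac{\lambda(s')-\lambda(s)}{s'-s}\Big|,$$ where $\Lambda$ is the set of strictly increasing continuous functions from $[0,1]$ onto $[0,1]$. Let $\mathbb{D}([0,1];\mathbb{D})$ be the space of functions $x:[0,1]\to\mathbb{D}$ that are right-continuous with left limits with respect to $d^0_{J_1}$, equipped with the metric $$d_{\mathbb{D}}(x,y)=\inf_{\lambda\in\Lambda}\Big\{\sup_{t\in[0,1]}|\lambda(t)-t|\vee\sup_{t\in[0,1]}d^0_{J_1}\big(x(t),y(\lambda(t))\big)\Big\}$$ and its Borel $\sigma$-field; write $x(t)=\{x(t,s)\}_{s\in[0,1]}$. For $x\in\mathbb{D}$ and $\delta>0$ let $$w''(x,\delta)=\sup_{s_1\le s\le s_2,\ s_2-s_1\le\delta}\big(|x(s)-x(s_1)|\wedge|x(s_2)-x(s)|\big).$$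 **Theorem.** Let $(X_n)_{n\ge1}$ and $X$ be random elements in $\mathbb{D}([0,1];\mathbb{D})$ defined on the same probability space $(\Omega,\mathcal{F},P)$. Let $T_X=\{t\in[0,1]: P(X(t)=X(t-))=1\}$, where $X(0-)=X(0)$ by convention. (In c) below, $P$ of a possibly non-measurable event is the outer probability.) Suppose that: a) $(X_n(t_1),\dots,X_n(t_k))\to(X(t_1),\dots,X(t_k))$ in distribution in $\mathbb{D}^k$, for all $k\ge 1$ and all $t_1,\dots,t_k\in T_X$; b) $d^0_{J_1}(X(1),X(1-\delta))\to0$ in probability as $\delta\downarrow0$; c) for every $\varepsilon>0$, $$\lim_{\delta\downarrow0}\limsup_{n\to\infty}P\big(w''(X_n(t),\delta)\ge\varepsilon\text{ for some }t\in[0,1]\big)=0,$$ $$\lim_{\delta\downarrow0}\limsup_{n\to\infty}P\big(|X_n(t,\delta)-X_n(t,0)|\ge\varepsilon\text{ for some }t\in[0,1]\big)=0,$$ $$\lim_{\delta\downarrow0}\limsup_{n\to\infty}P\big(|X_n(t,1-)-X_n(t,1-\delta)|\ge\varepsilon\text{ for some }t\in[0,1]\big)=0.$$ Suppose also that there exist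 $\alpha>1/2$, $\beta\ge0$ and a non-decreasing continuous function $F:[0,1]\to\mathbb{R}$ such that for all $r\le s\le t$ in $[0,1]$, all $\lambda>0$ and all $n\ge1$, $$P\Big(d^0_{J_1}(X_n(r),X_n(s))\wedge d^0_{J_1}(X_n(s),X_n(t))\ge\lambda\Big)\le\frac{1}{\lambda^{4\beta}}\,[F(t)-F(r)]^{2\alpha}.$$ Then $X_n\to X$ in distribution in $\mathbb{D}([0,1];\mathbb{D})$ equipped with $d_{\mathbb{D}}$. -/

import Mathlib

open Set Filter Topology MeasureTheory ProbabilityTheory unitInterval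
open scoped ENNReal

/-- Functions `[0,1] → S` that are right-continuous and have left limits. (At `1` right-continuity
is vacuous, and at `0` the existence of a left limit is vacuous, because `𝓝[<] 0 = ⊥`.) -/
structure Cadlag (S : Type*) [TopologicalSpace S] where
  toFun : I → S
  right_continuous' : ∀ t, ContinuousWithinAt toFun (Ici t) t
  left_limit' : ∀ t, ∃ l, Tendsto toFun (𝓝[<] t) (𝓝 l)

namespace Cadlag

instance {S : Type*} [TopologicalSpace S] : CoeFun (Cadlag S) (fun _ => I → S) := ⟨Cadlag.toFun⟩

/-- The set `Λ` of time changes: the order isomorphisms of `[0,1]`, that is, the strictly increasing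
continuous functions from `[0,1]` onto `[0,1]` (a strictly increasing surjection is an order
isomorphism, and continuity is automatic). -/
abbrev TimeChange : Type := I ≃o I

/-- `‖lam - e‖ = sup_s |lam(s) - s|`. -/
noncomputable def unifSize (lam : TimeChange) : ℝ≥0∞ := ⨆ s : I, edist (lam s) s

/-- `‖lam‖⁰ = sup_{s < s'} |log ((lam(s') - lam(s)) / (s' - s))|`, possibly infinite. -/
noncomputable def logSize (lam : TimeChange) : ℝ≥0∞ :=
  ⨆ (s : I) (s' : I) (_ : s < s'),
    ENNReal.ofReal |Real.log (((lam s' : ℝ) - lam s) / ((s' : ℝ) - s))|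

/-- `inf_lam (N(lam) ∨ sup_t dist (x(t), y(lam(t))))`, for `N` a way to measure the size of a time
change. -/
noncomputable def skorohodInf {S : Type*} [MetricSpace S] (N : TimeChange → ℝ≥0∞)
    (x y : Cadlag S) : ℝ≥0∞ :=
  ⨅ lam : TimeChange, max (N lam) (⨆ t : I, edist (x t) (y (lam t)))

/-- The properties of a size of time changes that make `skorohodInf` a metric. -/
structure IsSize (N : TimeChange → ℝ≥0∞) : Prop where
  refl : N (OrderIso.refl I) = 0
  symm_le : ∀ lam, N lam.symm ≤ N lam
  trans_le : ∀ lam mu : TimeChange, N (lam.trans mu) ≤ N lam + N mu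
  small : ∀ e : ℝ, 0 < e → ∃ d : ℝ≥0∞, 0 < d ∧ ∀ lam, N lam < d → ∀ s, dist (lam s) s < e

theorem isSize_unifSize : IsSize unifSize where
  refl := by simp [unifSize]
  symm_le lam := by
    refine iSup_le fun s => ?_
    have h := le_iSup (fun s : I => edist (lam s) s) (lam.symm s)
    simpa [unifSize, edist_comm] using h
  trans_le lam mu := by
    refine iSup_le fun s => ?_
    refine (edist_triangle _ (lam s) _).trans ?_
    rw [add_comm]
    exact add_le_add (le_iSup (fun s : I => edist (lam s) s) s)
      (le_iSup (fun s : I => edist (mu s) s) (lam s))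
  small e he := by
    refine ⟨ENNReal.ofReal e, by simpa using he, fun lam h s => ?_⟩
    have h1 := (le_iSup (fun s : I => edist (lam s) s) s).trans_lt h
    rwa [edist_lt_ofReal] at h1

theorem le_logSize (lam : TimeChange) {s s' : I} (h : s < s') :
    ENNReal.ofReal |Real.log (((lam s' : ℝ) - lam s) / ((s' : ℝ) - s))| ≤ logSize lam :=
  le_iSup₂_of_le s s' (le_iSup_of_le h le_rfl)

theorem isSize_logSize : IsSize logSize where
  refl := by
    simp only [logSize, OrderIso.refl_apply, ENNReal.iSup_eq_zero]
    intro s s' h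
    have h' : (s : ℝ) < s' := h
    have : ((s' : ℝ) - s) ≠ 0 := (sub_pos.2 h').ne'
    simp [div_self this]
  symm_le lam := by
    refine iSup_le fun s => iSup_le fun s' => iSup_le fun h => ?_
    have h1 := le_logSize lam (lam.symm.strictMono h)
    rw [lam.apply_symm_apply, lam.apply_symm_apply, ← inv_div, Real.log_inv, abs_neg] at h1
    exact h1
  trans_le lam mu := by
    refine iSup_le fun s => iSup_le fun s' => iSup_le fun h => ?_
    have h1 := le_logSize lam h
    have h2 := le_logSize mu (lam.strictMono h)
    refine le_trans ?_ (add_le_add h1 h2)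
    rw [← ENNReal.ofReal_add (abs_nonneg _) (abs_nonneg _)]
    refine ENNReal.ofReal_le_ofReal ?_
    have p0 : (0 : ℝ) < (s' : ℝ) - s := sub_pos.2 h
    have p1 : (0 : ℝ) < (lam s' : ℝ) - lam s := sub_pos.2 (lam.strictMono h)
    have p2 : (0 : ℝ) < (mu (lam s') : ℝ) - mu (lam s) :=
      sub_pos.2 (mu.strictMono (lam.strictMono h))
    have e : (((lam.trans mu) s' : ℝ) - (lam.trans mu) s) / ((s' : ℝ) - s)
        = (((lam s' : ℝ) - lam s) / ((s' : ℝ) - s)) *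
          (((mu (lam s') : ℝ) - mu (lam s)) / ((lam s' : ℝ) - lam s)) := by
      simp only [OrderIso.trans_apply]
      field_simp
    rw [e, Real.log_mul (div_pos p1 p0).ne' (div_pos p2 p1).ne']
    exact abs_add_le _ _
  small e he := by
    have hc : Tendsto (fun d : ℝ => Real.exp d - 1) (𝓝 0) (𝓝 0) := by
      have : Continuous fun d : ℝ => Real.exp d - 1 := by fun_prop
      simpa using this.tendsto 0
    have hc' : Tendsto (fun d : ℝ => 1 - Real.exp (-d)) (𝓝 0) (𝓝 0) := by
      have : Continuous fun d : ℝ => 1 - Real.exp (-d) := by fun_prop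
      simpa using this.tendsto 0
    obtain ⟨d, ⟨hd1, hd2⟩, hd0⟩ := (((hc.eventually_lt_const he).and
      (hc'.eventually_lt_const he)).filter_mono nhdsWithin_le_nhds |>.and
      (self_mem_nhdsWithin (s := Ioi (0 : ℝ)))).exists
    refine ⟨ENNReal.ofReal d, by simpa using hd0, fun lam hl s => ?_⟩
    have hl0 : lam 0 = 0 := lam.map_bot
    rcases eq_or_lt_of_le (unitInterval.nonneg' (t := s)) with rfl | hs
    · simpa [hl0] using he
    have h1 := (le_logSize lam hs).trans_lt hl
    rw [ENNReal.ofReal_lt_ofReal_iff hd0, hl0] at h1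
    have hs' : (0 : ℝ) < s := hs
    have hls : (0 : ℝ) < lam s := by
      have := lam.strictMono hs
      rw [hl0] at this
      exact this
    simp only [Icc.coe_zero, sub_zero, abs_lt] at h1
    have hlt : (lam s : ℝ) / s < Real.exp d := (Real.log_lt_iff_lt_exp (div_pos hls hs')).1 h1.2
    have hgt : Real.exp (-d) < (lam s : ℝ) / s := (Real.lt_log_iff_exp_lt (div_pos hls hs')).1 h1.1
    rw [div_lt_iff₀ hs'] at hlt
    rw [lt_div_iff₀ hs'] at hgt
    have hs1 : (s : ℝ) ≤ 1 := s.2.2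
    rw [Subtype.dist_eq, Real.dist_eq, abs_lt]
    have e1 : 0 < Real.exp d - 1 := by simpa using hd0
    have e2 : 0 < 1 - Real.exp (-d) := by simpa using hd0
    constructor <;> nlinarith

section

variable {S : Type*} [MetricSpace S]

/-- A càdlàg function is bounded. -/
theorem isBounded_range (x : Cadlag S) : Bornology.IsBounded (range x) := by
  rw [← image_univ]
  refine isCompact_univ.induction_on (p := fun s => Bornology.IsBounded (x.toFun '' s)) (by simp)
    (fun s t hst ht => ht.subset (image_mono hst))
    (fun s t hs ht => by rw [image_union]; exact hs.union ht) fun t _ => ?_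
  obtain ⟨l, hl⟩ := x.left_limit' t
  have hr : Tendsto x.toFun (𝓝[≥] t) (𝓝 (x t)) := x.right_continuous' t
  have ha := hl (Metric.ball_mem_nhds l one_pos)
  have hb := hr (Metric.ball_mem_nhds (x t) one_pos)
  refine ⟨x.toFun ⁻¹' (Metric.ball l 1 ∪ Metric.ball (x t) 1), ?_, ?_⟩
  · rw [nhdsWithin_univ, ← nhdsLT_sup_nhdsGE]
    exact ⟨mem_of_superset ha (preimage_mono subset_union_left),
      mem_of_superset hb (preimage_mono subset_union_right)⟩
  · exact (Metric.isBounded_ball.union Metric.isBounded_ball).subset (image_preimage_subset _ _)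

theorem skorohodInf_ne_top {N : TimeChange → ℝ≥0∞} (hN : IsSize N) (x y : Cadlag S) :
    skorohodInf N x y ≠ ⊤ := by
  obtain ⟨C, hC⟩ := Metric.isBounded_iff.1 (x.isBounded_range.union y.isBounded_range)
  have hle : skorohodInf N x y ≤ ENNReal.ofReal C := by
    refine (iInf_le _ (OrderIso.refl I)).trans (max_le (by simp [hN.refl]) (iSup_le fun t => ?_))
    rw [edist_dist]
    exact ENNReal.ofReal_le_ofReal (hC (Or.inl (mem_range_self _)) (Or.inr (mem_range_self _)))
  exact (hle.trans_lt ENNReal.ofReal_lt_top).ne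

theorem skorohodInf_symm_le {N : TimeChange → ℝ≥0∞} (hN : IsSize N) (x y : Cadlag S) :
    skorohodInf N y x ≤ skorohodInf N x y := by
  refine le_iInf fun lam => (iInf_le _ lam.symm).trans ?_
  refine max_le_max (hN.symm_le lam) (iSup_le fun t => ?_)
  have h := le_iSup (fun t : I => edist (x t) (y (lam t))) (lam.symm t)
  simpa [edist_comm] using h

theorem skorohodInf_triangle {N : TimeChange → ℝ≥0∞} (hN : IsSize N) (x y z : Cadlag S) :
    skorohodInf N x z ≤ skorohodInf N x y + skorohodInf N y z := by
  simp only [skorohodInf, ENNReal.iInf_add, ENNReal.add_iInf]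
  refine le_iInf fun lam => le_iInf fun mu => (iInf_le _ (mu.trans lam)).trans ?_
  refine max_le ?_ (iSup_le fun t => ?_)
  · refine (hN.trans_le mu lam).trans ?_
    exact add_le_add (le_max_left (N mu) _) (le_max_left (N lam) _)
  · refine (edist_triangle _ (y (mu t)) _).trans ?_
    exact add_le_add ((le_iSup (fun t : I => edist (x t) (y (mu t))) t).trans (le_max_right _ _))
      ((le_iSup (fun t : I => edist (y t) (z (lam t))) (mu t)).trans (le_max_right _ _))

theorem eq_of_skorohodInf_eq_zero {N : TimeChange → ℝ≥0∞} (hN : IsSize N) {x y : Cadlag S}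
    (h : skorohodInf N x y = 0) : x = y := by
  have key : ∀ e : ℝ, 0 < e → ∃ lam : TimeChange,
      (∀ s, dist (lam s) s < e) ∧ ∀ t, dist (x t) (y (lam t)) < e := by
    intro e he
    obtain ⟨d, hd, hsm⟩ := hN.small e he
    have hlt : skorohodInf N x y < min d (ENNReal.ofReal e) := by
      rw [h]; exact lt_min hd (by simpa using he)
    obtain ⟨lam, hl⟩ := iInf_lt_iff.1 hlt
    refine ⟨lam, hsm lam ((le_max_left _ _).trans_lt (hl.trans_le (min_le_left _ _))), fun t => ?_⟩
    have h1 := (le_iSup (fun t : I => edist (x t) (y (lam t))) t).trans_lt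
      ((le_max_right _ _).trans_lt (hl.trans_le (min_le_right _ _)))
    rwa [edist_lt_ofReal] at h1
  have hfun : ∀ t, x t = y t := by
    intro t
    refine eq_of_forall_dist_le fun e he => ?_
    rcases eq_or_lt_of_le t.2.2 with ht1 | ht1
    · have ht : t = 1 := Subtype.ext ht1
      subst ht
      obtain ⟨lam, -, h2⟩ := key e he
      have h3 := h2 1
      rw [show lam 1 = 1 from lam.map_top] at h3
      exact h3.le
    · have hx := Metric.continuousWithinAt_iff.1 (x.right_continuous' t) (e / 3) (by positivity)
      have hy := Metric.continuousWithinAt_iff.1 (y.right_continuous' t) (e / 3) (by positivity)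
      obtain ⟨a, ha, hxa⟩ := hx
      obtain ⟨b, hb, hyb⟩ := hy
      set c : ℝ := min (min a b) (1 - t) with hc
      have hc0 : 0 < c := lt_min (lt_min ha hb) (by linarith)
      have hca : c ≤ a := (min_le_left _ _).trans (min_le_left _ _)
      have hcb : c ≤ b := (min_le_left _ _).trans (min_le_right _ _)
      have hct : c ≤ 1 - t := min_le_right _ _
      have ht0 : (0 : ℝ) ≤ t := t.2.1
      let s : I := ⟨t + c / 2, by constructor <;> linarith⟩
      have hs : (s : ℝ) = t + c / 2 := rfl
      obtain ⟨lam, h1, h2⟩ := key (min (c / 2) (e / 3)) (by positivity)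
      have h1s := (h1 s).trans_le (min_le_left _ _)
      have h2s := (h2 s).trans_le (min_le_right _ _)
      rw [Subtype.dist_eq, Real.dist_eq, abs_lt] at h1s
      have d1 : dist (x s) (x t) < e / 3 := by
        refine hxa (x := s) (show (t : ℝ) ≤ s by linarith) ?_
        rw [Subtype.dist_eq, Real.dist_eq, abs_lt]
        constructor <;> linarith
      have d2 : dist (y (lam s)) (y t) < e / 3 := by
        refine hyb (x := lam s) (show (t : ℝ) ≤ lam s by linarith) ?_
        rw [Subtype.dist_eq, Real.dist_eq, abs_lt]
        constructor <;> linarith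
      have t1 := dist_triangle4 (x t) (x s) (y (lam s)) (y t)
      rw [dist_comm (x t) (x s)] at t1
      linarith
  cases x; cases y
  congr
  exact funext hfun

/-- The metric `inf_lam (N(lam) ∨ sup_t dist (x(t), y(lam(t))))` on càdlàg functions. -/
noncomputable abbrev metricOfSize (N : TimeChange → ℝ≥0∞) (hN : IsSize N) :
    MetricSpace (Cadlag S) :=
  letI : EMetricSpace (Cadlag S) :=
    { edist := skorohodInf N
      edist_self := fun x => nonpos_iff_eq_zero.1 <|
        (iInf_le _ (OrderIso.refl I)).trans (by simp [hN.refl])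
      edist_comm := fun x y =>
        le_antisymm (skorohodInf_symm_le hN y x) (skorohodInf_symm_le hN x y)
      edist_triangle := skorohodInf_triangle hN
      eq_of_edist_eq_zero := fun h => eq_of_skorohodInf_eq_zero hN h }
  EMetricSpace.toMetricSpace (skorohodInf_ne_top hN)

end

end Cadlag

/-- The Skorohod space `𝔻` of real càdlàg functions on `[0,1]`. -/
def DSpace : Type := Cadlag ℝ

namespace DSpace

instance : CoeFun DSpace (fun _ => I → ℝ) := ⟨Cadlag.toFun⟩

/-- `𝔻` carries the metric `d⁰_{J₁}(x,y) = inf_lam (‖lam‖⁰ ∨ ‖x - y ∘ lam‖)`, which generates the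
`J₁` topology. -/
noncomputable instance : MetricSpace DSpace :=
  Cadlag.metricOfSize (S := ℝ) Cadlag.logSize Cadlag.isSize_logSize

end DSpace

/-- The space `𝔻([0,1];𝔻)` of functions on `[0,1]` with values in `𝔻` that are right-continuous
and have left limits with respect to `J₁`. -/
def DDSpace : Type := Cadlag DSpace

namespace DDSpace

instance : CoeFun DDSpace (fun _ => I → DSpace) := ⟨Cadlag.toFun⟩

/-- `𝔻([0,1];𝔻)` carries the Skorohod metric
`d_𝔻(x,y) = inf_lam (‖lam - e‖ ∨ sup_t d⁰_{J₁}(x(t), y(lam(t))))`. -/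
noncomputable instance : MetricSpace DDSpace :=
  Cadlag.metricOfSize (S := DSpace) Cadlag.unifSize Cadlag.isSize_unifSize

/-- The Borel σ-field of `d_𝔻`. -/
noncomputable instance : MeasurableSpace DDSpace := borel DDSpace

instance : BorelSpace DDSpace := ⟨rfl⟩

end DDSpace

/-- The modulus
`w''(x,δ) = sup { |x(s) - x(s₁)| ∧ |x(s₂) - x(s)| : s₁ ≤ s ≤ s₂, s₂ - s₁ ≤ δ }`. -/
noncomputable def wSecond (x : DSpace) (δ : ℝ) : ℝ :=
  sSup {r : ℝ | ∃ s₁ s s₂ : I, s₁ ≤ s ∧ s ≤ s₂ ∧ (s₂ : ℝ) - s₁ ≤ δ ∧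
    r = min |x s - x s₁| |x s₂ - x s|}

/-- Convergence in distribution of maps into a topological space `S` with its Borel σ-field:
weak convergence of the laws. -/
def ConvInDistr {Ω S : Type*} [MeasurableSpace Ω] [TopologicalSpace S]
    (P : Measure Ω) [IsProbabilityMeasure P] (Y : ℕ → Ω → S) (Z : Ω → S) : Prop :=
  letI : MeasurableSpace S := borel S
  haveI : BorelSpace S := ⟨rfl⟩
  TendstoInDistribution Y atTop Z (fun _ => P) P

/-- `T_X = {t ∈ [0,1] : P(X(t) = X(t-)) = 1}`, with `X(t-)` the left limit in `J₁`, and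
`X(0-) = X(0)` (the value of `Function.leftLim` at `0`), so that `0 ∈ T_X`. -/
def fixedContinuityTimes {Ω : Type*} [MeasurableSpace Ω] (P : Measure Ω) (X : Ω → DDSpace) :
    Set I :=
  {t | ∀ᵐ ω ∂P, X ω t = Function.leftLim (X ω) t}

/-! The laws are compared through step approximations, with no appeal to compactness. Fix a finite
grid of times in `T_X` and replace a path by the step path with the same values on the grid. The
step path depends continuously on these finitely many values (`Grid.continuous_stepDD`), so by a)
the step versions of `X_n` converge in distribution to that of `X`. As the mesh shrinks, the step
versions of `X` converge almost surely to `X`, which by b) almost surely has no jump at `1`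
(`Cadlag.tendsto_skorohodInf_step`). By `tendstoInDistribution_of_approx` it remains to see that on
a fine grid the step version of `X_n` is close to `X_n` in probability, uniformly over large `n`.

This rests on a deterministic fact and an estimate. The fact is `Grid.Fine.skorohodInf_step_le`: if
one of any two successive increments in a short window is small, then large jumps are far apart and
the path barely moves across a short interval without one, so a time change carrying each large jump
to the next grid point brings the path close to its step version. Small increments next to `0` and
`1` keep the large jumps away from the end points, which every time change fixes. The estimate is
`exists_smallIncrements_of_moment_bound`: dyadic chaining, in a clock that dominates `F`. Level `k`
has at most `2 ^ k` triples, and each fails with probability of order `2 ^ (-2αk) θ ^ (-4βk)`; this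
sums because `2α > 1` and `θ` can be taken near `1`.

Smallness next to the end points holds for `X`, by right-continuity at `0` and by b) at `1`, and
passes to `X_n` by a). Suitable grids exist because `T_X` contains both end points and has countable
complement (`countable_compl_fixedContinuityTimes`). -/

theorem exists_orderIso_of_strictMono {L : I → ℝ} (hm : StrictMono L) (hc : Continuous L)
    (h0 : L 0 = 0) (h1 : L 1 = 1) : ∃ e : I ≃o I, ∀ t, (e t : ℝ) = L t := by
  have hLI : ∀ t, L t ∈ Icc (0 : ℝ) 1 := fun t =>
    ⟨h0 ▸ hm.monotone unitInterval.nonneg', h1 ▸ hm.monotone unitInterval.le_one'⟩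
  let L' : I → I := fun t => ⟨L t, hLI t⟩
  have hm' : StrictMono L' := fun s t hst => hm hst
  have hsurj : Function.Surjective L' := by
    intro c
    obtain ⟨t, ht⟩ := mem_range_of_exists_le_of_exists_ge hc
      ⟨0, h0.trans_le c.2.1⟩ ⟨1, h1.symm ▸ c.2.2⟩
    exact ⟨t, Subtype.ext ht⟩
  exact ⟨StrictMono.orderIsoOfSurjective L' hm' hsurj, fun t => rfl⟩

/-- Among any three successive times in a window of length `δ`, one of the two successive increments
of `x` is at most `η`. -/
def SmallIncrements {S : Type*} [MetricSpace S] (x : I → S) (δ η : ℝ) : Prop :=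
  ∀ r s t : I, r ≤ s → s ≤ t → (t : ℝ) - r ≤ δ → min (dist (x r) (x s)) (dist (x s) (x t)) ≤ η

/-! ### Jumps of paths with small increments, and time changes that move them -/

namespace Cadlag

variable {S : Type*} [MetricSpace S]

theorem tendsto_leftLim (x : Cadlag S) (t : I) :
    Tendsto x (𝓝[<] t) (𝓝 (Function.leftLim x t)) := by
  rcases eq_or_neBot (𝓝[<] t) with h | h
  · simp [h]
  · obtain ⟨l, hl⟩ := x.left_limit' t
    rwa [leftLim_eq_of_tendsto hl]

/-- The size of the jump of `x` at `t`. -/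
noncomputable def jump (x : Cadlag S) (t : I) : ℝ := dist (Function.leftLim x t) (x t)

theorem tendsto_dist_jump (x : Cadlag S) (t : I) :
    Tendsto (fun s => dist (x s) (x t)) (𝓝[<] t) (𝓝 (x.jump t)) :=
  (x.tendsto_leftLim t).dist tendsto_const_nhds

theorem nhdsLT_neBot_of_jump_pos {x : Cadlag S} {t : I} (h : 0 < x.jump t) : (𝓝[<] t).NeBot := by
  rcases eq_or_neBot (𝓝[<] t) with h' | h'
  · simp [jump, leftLim_eq_of_eq_bot _ h'] at h
  · exact h'

theorem jump_le_of_eventually {x : Cadlag S} {t : I} {c : ℝ} (hc : 0 ≤ c)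
    (h : ∀ᶠ s in 𝓝[<] t, dist (x s) (x t) ≤ c) : x.jump t ≤ c := by
  rcases eq_or_neBot (𝓝[<] t) with h' | h'
  · simpa [jump, leftLim_eq_of_eq_bot _ h'] using hc
  · exact le_of_tendsto (x.tendsto_dist_jump t) h

/-- Let `c` be the infimum of the times in `[u, v]` where `x` is `η`-close to `x v`. By
right-continuity `x c` is still close to `x v`; just before `c` the path is not, hence it is close
to `x u` there. Only the jump at `c` separates the two regimes. -/
theorem dist_le_of_jump_le {x : Cadlag S} {δ η ζ : ℝ} (hη : 0 ≤ η) (hζ : 0 ≤ ζ)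
    (hx : SmallIncrements x δ η) {u v : I} (huv : u ≤ v) (hδ : (v : ℝ) - u ≤ δ)
    (hj : ∀ c, u < c → c ≤ v → x.jump c ≤ ζ) : dist (x u) (x v) ≤ 2 * η + ζ := by
  set B : Set I := {s | u ≤ s ∧ s ≤ v ∧ dist (x s) (x v) ≤ η} with hB
  have hvB : v ∈ B := ⟨huv, le_rfl, by simpa using hη⟩
  obtain ⟨c, hc⟩ : ∃ c, IsGLB B c := ⟨sInf B, isGLB_sInf B⟩
  have huc : u ≤ c := hc.2 fun s hs => hs.1
  have hcv : c ≤ v := hc.1 hvB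
  have hcr : dist (x c) (x v) ≤ η := by
    have hr : Tendsto x (𝓝[≥] c) (𝓝 (x c)) := x.right_continuous' c
    exact le_of_tendsto_of_frequently (hr.dist tendsto_const_nhds)
      ((hc.frequently_mem ⟨v, hvB⟩).mono fun s hs => hs.2.2)
  rcases huc.eq_or_lt with rfl | huc
  · linarith
  · have hne : (𝓝[<] c).NeBot := nhdsLT_neBot_of_exists_lt ⟨u, huc⟩
    have hl : dist (x u) (Function.leftLim x c) ≤ η := by
      refine le_of_tendsto (tendsto_const_nhds.dist (x.tendsto_leftLim c)) ?_
      filter_upwards [Ioo_mem_nhdsLT huc] with s hs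
      have hsB : s ∉ B := fun h => (hc.1 h).not_gt hs.2
      have hsv : s ≤ v := hs.2.le.trans hcv
      rcases min_le_iff.1 (hx u s v hs.1.le hsv hδ) with h | h
      · exact h
      · exact absurd ⟨hs.1.le, hsv, h⟩ hsB
    have h3 := hj c huc hcv
    have := dist_triangle4 (x u) (Function.leftLim x c) (x c) (x v)
    rw [jump] at h3
    linarith

/-- Otherwise take `r` just before `u` and `s` just before `v`. The jump at `v` forces `x r` close
to `x s`, the jump at `u` forces `x u` close to `x s`, and then the jump at `u` is too small. -/
theorem le_sub_of_lt_jump {x : Cadlag S} {δ η : ℝ} (hη : 0 ≤ η) (hx : SmallIncrements x δ η)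
    {u v : I} (huv : u < v) (hu : 2 * η < x.jump u) (hv : 2 * η < x.jump v) :
    δ ≤ (v : ℝ) - u := by
  by_contra! hlt
  have := nhdsLT_neBot_of_jump_pos (x := x) (t := u) (by linarith)
  have := nhdsLT_neBot_of_jump_pos (x := x) (t := v) (by linarith)
  have hcont : Tendsto (fun r : I => (v : ℝ) - r) (𝓝[<] u) (𝓝 ((v : ℝ) - u)) :=
    (by fun_prop : Continuous fun r : I => (v : ℝ) - r).continuousAt.tendsto.mono_left
      nhdsWithin_le_nhds
  obtain ⟨r, ⟨hr1, hr2⟩, hr3⟩ := (((x.tendsto_dist_jump u).eventually_const_lt hu).and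
    (hcont.eventually_lt_const hlt)|>.and self_mem_nhdsWithin).exists
  obtain ⟨s, hs1, hs2⟩ := (((x.tendsto_dist_jump v).eventually_const_lt hv).and
    (Ioo_mem_nhdsLT huv)).exists
  have hru : r < u := hr3
  have h1 := hx r s v (hru.le.trans hs2.1.le) hs2.2.le hr2.le
  have h2 := hx r u s hru.le hs2.1.le
    (by have : (s : ℝ) ≤ v := hs2.2.le
        linarith)
  have h3 : dist (x r) (x s) ≤ η := by
    rcases min_le_iff.1 h1 with h | h
    · exact h
    · linarith
  have h4 : dist (x u) (x s) ≤ η := by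
    rcases min_le_iff.1 h2 with h | h
    · linarith
    · exact h
  have := dist_triangle_right (x r) (x u) (x s)
  linarith

/-- Every value on `[0, a]` is within `2 * η` of `x 0`, whichever alternative of the small-increment
condition holds for `0`, `s`, `a`. -/
theorem jump_le_of_le {x : Cadlag S} {δ η : ℝ} (hη : 0 ≤ η) (hx : SmallIncrements x δ η) {a : I}
    (ha : (a : ℝ) ≤ δ) (h : dist (x 0) (x a) ≤ η) {t : I} (ht : t ≤ a) : x.jump t ≤ 4 * η := by
  have key : ∀ s ≤ a, dist (x 0) (x s) ≤ 2 * η := by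
    intro s hs
    rcases min_le_iff.1 (hx 0 s a unitInterval.nonneg' hs (by simpa using ha)) with h' | h'
    · linarith
    · have := dist_triangle_right (x 0) (x s) (x a)
      linarith
  refine jump_le_of_eventually (by linarith) ?_
  filter_upwards [self_mem_nhdsWithin] with s hs
  have h1 := key s ((show s < t from hs).le.trans ht)
  have h2 := key t ht
  have := dist_triangle_left (x s) (x t) (x 0)
  linarith

theorem jump_le_of_lt {x : Cadlag S} {δ η : ℝ} (hη : 0 ≤ η) (hx : SmallIncrements x δ η) {b : I}
    (hb : 1 - (b : ℝ) ≤ δ) (h : dist (x b) (x 1) ≤ η) {t : I} (ht : b < t) :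
    x.jump t ≤ 4 * η := by
  have key : ∀ s, b ≤ s → dist (x s) (x 1) ≤ 2 * η := by
    intro s hs
    rcases min_le_iff.1 (hx b s 1 hs unitInterval.le_one' (by simpa using hb)) with h' | h'
    · have := dist_triangle_left (x s) (x 1) (x b)
      linarith
    · linarith
  refine jump_le_of_eventually (by linarith) ?_
  filter_upwards [Ioo_mem_nhdsLT ht] with s hs
  have h1 := key s hs.1.le
  have h2 := key t ht.le
  have := dist_triangle_right (x s) (x t) (x 1)
  linarith

/-- A time change with prescribed values at well separated times. -/
theorem exists_timeChange {T : Set I} {h : ℝ} (hh : 0 ≤ h) (h1 : 4 * h ≤ 1)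
    (hsep : ∀ u ∈ T, ∀ v ∈ T, u < v → 4 * h ≤ (v : ℝ) - u)
    (hT0 : ∀ u ∈ T, 4 * h ≤ (u : ℝ)) (hT1 : ∀ u ∈ T, 4 * h ≤ 1 - (u : ℝ))
    (f : I → I) (hf : ∀ u ∈ T, |(f u : ℝ) - u| ≤ h) :
    ∃ lam : TimeChange, (∀ u ∈ T, lam u = f u) ∧ ∀ t, |(lam t : ℝ) - t| ≤ h := by
  classical
  -- When `h = 0` the separation hypotheses do not keep the end points out of `T`, but then `f` is
  -- the identity on `T`.
  rcases hh.eq_or_lt with rfl | hh0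
  · refine ⟨OrderIso.refl I, fun u hu => ?_, fun t => by simp⟩
    have := abs_nonpos_iff.1 (hf u hu)
    exact Subtype.ext (by simp; linarith)
  set R : Set I := insert 0 (insert 1 T) with hR
  set φ₀ : I → ℝ := fun t => if t ∈ T then (f t : ℝ) - t else 0 with hφ₀
  have h0T : (0 : I) ∉ T := fun h => by have := hT0 _ h; simp at this; linarith
  have h1T : (1 : I) ∉ T := fun h => by have := hT1 _ h; simp at this; linarith
  have hφ₀b : ∀ t, |φ₀ t| ≤ h := by
    intro t
    simp only [hφ₀]
    split_ifs with ht
    · exact hf t ht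
    · simpa using hh
  have hsepR : ∀ u ∈ R, ∀ v ∈ R, u < v → 4 * h ≤ (v : ℝ) - u := by
    rintro u (rfl | rfl | hu) v (rfl | rfl | hv) huv
    · exact absurd huv (lt_irrefl _)
    · simpa using h1
    · simpa using hT0 v hv
    · exact absurd huv unitInterval.nonneg'.not_gt
    · exact absurd huv (lt_irrefl _)
    · exact absurd huv unitInterval.le_one'.not_gt
    · exact absurd huv unitInterval.nonneg'.not_gt
    · simpa using hT1 u hu
    · exact hsep u hu v hv huv
  -- Two displacements differ by at most `2 * h` and their times by at least `4 * h`. A Lipschitz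
  -- constant below `1` survives extension and clamping, and makes identity plus displacement
  -- strictly increasing.
  have hlip : LipschitzOnWith (1 / 2) φ₀ R := by
    refine LipschitzOnWith.of_dist_le_mul fun u hu v hv => ?_
    rcases eq_or_ne u v with rfl | hne
    · simp
    have hd : 4 * h ≤ dist u v := by
      rw [Subtype.dist_eq, Real.dist_eq]
      rcases lt_or_gt_of_ne hne with hlt | hlt
      · rw [abs_sub_comm]
        exact (hsepR u hu v hv hlt).trans (le_abs_self _)
      · exact (hsepR v hv u hu hlt).trans (le_abs_self _)
    have hu' := abs_le.1 (hφ₀b u)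
    have hv' := abs_le.1 (hφ₀b v)
    rw [Real.dist_eq, abs_le]
    push_cast
    constructor <;> linarith
  obtain ⟨g, hg, hgeq⟩ := hlip.extend_real
  set L : I → ℝ := fun t => t + max (-h) (min h (g t)) with hL
  have hclamp : ∀ t ∈ R, max (-h) (min h (g t)) = φ₀ t := by
    intro t ht
    have hb := abs_le.1 (hφ₀b t)
    rw [← hgeq ht, min_eq_right hb.2, max_eq_right hb.1]
  have hL0 : L 0 = 0 := by
    simp only [hL]
    rw [hclamp 0 (by simp [hR])]
    simp [hφ₀, h0T]
  have hL1 : L 1 = 1 := by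
    simp only [hL]
    rw [hclamp 1 (by simp [hR])]
    simp [hφ₀, h1T]
  have hcl : LipschitzWith (1 / 2) fun t => max (-h) (min h (g t)) :=
    (hg.const_min h).const_max (-h)
  have hLmono : StrictMono L := by
    intro s t hst
    have hst' : (s : ℝ) < t := hst
    have := hcl.dist_le_mul s t
    rw [Subtype.dist_eq, Real.dist_eq, Real.dist_eq, abs_sub_comm (s : ℝ),
      abs_of_pos (sub_pos.2 hst')] at this
    have := (abs_le.1 this).2
    push_cast at this
    simp only [hL]
    linarith
  have hLcont : Continuous L := continuous_subtype_val.add hcl.continuous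
  obtain ⟨lam, hlam⟩ := exists_orderIso_of_strictMono hLmono hLcont hL0 hL1
  refine ⟨lam, fun u hu => Subtype.ext ?_, fun t => ?_⟩
  · rw [hlam]
    simp only [hL]
    rw [hclamp u (by simp [hR, hu])]
    simp [hφ₀, hu]
  · rw [hlam]
    simp only [hL, add_sub_cancel_left, abs_le]
    exact ⟨le_max_left _ _, max_le (by linarith) (min_le_left _ _)⟩

end Cadlag

/-! ### Grids and step approximations -/

/-- A finite set of times containing both end points. -/
structure Grid where
  pts : Finset I
  zero_mem : 0 ∈ pts
  one_mem : 1 ∈ pts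

namespace Grid

variable {S : Type*} [MetricSpace S] (g : Grid)

/-- The last grid point not after `t`. -/
noncomputable def floor (t : I) : I :=
  (g.pts.filter (· ≤ t)).max' ⟨0, by simp [g.zero_mem]⟩

/-- The first grid point not before `t`. -/
noncomputable def ceil (t : I) : I :=
  (g.pts.filter (t ≤ ·)).min' ⟨1, by simp [g.one_mem, unitInterval.le_one']⟩

theorem floor_mem (t : I) : g.floor t ∈ g.pts :=
  (Finset.mem_filter.1 (Finset.max'_mem (g.pts.filter (· ≤ t)) _)).1

theorem floor_le (t : I) : g.floor t ≤ t :=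
  (Finset.mem_filter.1 (Finset.max'_mem (g.pts.filter (· ≤ t)) _)).2

theorem le_floor {q t : I} (hq : q ∈ g.pts) (h : q ≤ t) : q ≤ g.floor t :=
  Finset.le_max' _ _ (Finset.mem_filter.2 ⟨hq, h⟩)

theorem ceil_mem (t : I) : g.ceil t ∈ g.pts :=
  (Finset.mem_filter.1 (Finset.min'_mem (g.pts.filter (t ≤ ·)) _)).1

theorem le_ceil (t : I) : t ≤ g.ceil t :=
  (Finset.mem_filter.1 (Finset.min'_mem (g.pts.filter (t ≤ ·)) _)).2

theorem ceil_le {q t : I} (hq : q ∈ g.pts) (h : t ≤ q) : g.ceil t ≤ q :=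
  Finset.min'_le _ _ (Finset.mem_filter.2 ⟨hq, h⟩)

theorem floor_congr {s t : I} (h : ∀ q ∈ g.pts, q ≤ s ↔ q ≤ t) : g.floor s = g.floor t := by
  refine le_antisymm (g.le_floor (g.floor_mem s) ?_) (g.le_floor (g.floor_mem t) ?_)
  · exact (h _ (g.floor_mem s)).1 (g.floor_le s)
  · exact (h _ (g.floor_mem t)).2 (g.floor_le t)

/-- The càdlàg step function with value `y q` from the grid point `q` to the next one. -/
noncomputable def step (y : g.pts → S) : Cadlag S where
  toFun t := y ⟨g.floor t, g.floor_mem t⟩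
  right_continuous' t := by
    refine tendsto_const_nhds.congr' ?_
    have : ∀ᶠ s in 𝓝[≥] t, ∀ q ∈ g.pts, (q ≤ s ↔ q ≤ t) := by
      rw [Finset.eventually_all]
      intro q _
      rcases le_or_gt q t with h | h
      · filter_upwards [self_mem_nhdsWithin] with s hs
        simp only [h, iff_true]
        exact h.trans hs
      · filter_upwards [mem_nhdsWithin_of_mem_nhds (Iio_mem_nhds h)] with s hs
        exact iff_of_false hs.not_ge h.not_ge
    filter_upwards [this] with s hs
    simp only [g.floor_congr hs]
  left_limit' t := by
    rcases eq_or_neBot (𝓝[<] t) with h | h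
    · exact ⟨y ⟨0, g.zero_mem⟩, by simp [h]⟩
    have : ∀ᶠ s in 𝓝[<] t, ∀ q ∈ g.pts, (q ≤ s ↔ q < t) := by
      rw [Finset.eventually_all]
      intro q _
      rcases lt_or_ge q t with h | h
      · filter_upwards [Ioo_mem_nhdsLT h] with s hs
        exact iff_of_true hs.1.le h
      · filter_upwards [self_mem_nhdsWithin] with s hs
        exact iff_of_false ((show s < t from hs).trans_le h).not_ge h.not_gt
    obtain ⟨s₀, hs₀⟩ := this.exists
    refine ⟨y ⟨g.floor s₀, g.floor_mem s₀⟩, tendsto_const_nhds.congr' ?_⟩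
    filter_upwards [this] with s hs
    simp only [g.floor_congr fun q hq => (hs₀ q hq).trans (hs q hq).symm]

/-- Every time is within `h` of grid points on both sides. -/
def Fine (h : ℝ) : Prop := ∀ t : I,
  (∃ q ∈ g.pts, q ≤ t ∧ (t : ℝ) - q ≤ h) ∧ ∃ q ∈ g.pts, t ≤ q ∧ (q : ℝ) - t ≤ h

variable {g}

theorem Fine.sub_floor_le {h : ℝ} (hg : g.Fine h) (t : I) : (t : ℝ) - g.floor t ≤ h := by
  obtain ⟨q, hq, hqt, hh⟩ := (hg t).1
  have : (q : ℝ) ≤ g.floor t := g.le_floor hq hqt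
  linarith

theorem Fine.ceil_sub_le {h : ℝ} (hg : g.Fine h) (t : I) : (g.ceil t : ℝ) - t ≤ h := by
  obtain ⟨q, hq, hqt, hh⟩ := (hg t).2
  have : (g.ceil t : ℝ) ≤ q := g.ceil_le hq hqt
  linarith

/-- A càdlàg function with small increments is close to its step approximations. -/
theorem Fine.skorohodInf_step_le {h δ η : ℝ} (hg : g.Fine h) (hh : 0 ≤ h) (hη : 0 ≤ η)
    {x : Cadlag S} (hx : SmallIncrements x δ η) {a b : I} (haδ : (a : ℝ) ≤ δ)
    (hbδ : 1 - (b : ℝ) ≤ δ) (hxa : dist (x 0) (x a) ≤ η) (hxb : dist (x b) (x 1) ≤ η)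
    (ha : 4 * h ≤ a) (hb : 4 * h ≤ 1 - (b : ℝ)) :
    Cadlag.skorohodInf Cadlag.unifSize (g.step fun q => x q) x ≤
      ENNReal.ofReal (max h (6 * η)) := by
  refine (Cadlag.skorohodInf_symm_le Cadlag.isSize_unifSize x _).trans ?_
  -- The threshold `4 * η` is the bound for jumps near the end points, so `T` lies in `(a, b]`; it
  -- also exceeds the `2 * η` needed for separation. That `δ` is at least `4 * h` follows from `4 *
  -- h ≤ a ≤ δ`.
  set T : Set I := {t | 4 * η < x.jump t} with hT
  have hTa : ∀ t ∈ T, a < t := fun t ht => not_le.1 fun h' =>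
    (Cadlag.jump_le_of_le hη hx haδ hxa h').not_gt ht
  have hTb : ∀ t ∈ T, t ≤ b := fun t ht => not_lt.1 fun h' =>
    (Cadlag.jump_le_of_lt hη hx hbδ hxb h').not_gt ht
  obtain ⟨lam, hlam, hlamh⟩ := Cadlag.exists_timeChange (T := T) hh (ha.trans a.2.2)
    (fun u hu v hv huv => ha.trans (haδ.trans (Cadlag.le_sub_of_lt_jump hη hx huv
      (by have : 4 * η < x.jump u := hu
          linarith)
      (by have : 4 * η < x.jump v := hv
          linarith))))
    (fun u hu => ha.trans (hTa u hu).le)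
    (fun u hu => hb.trans (sub_le_sub_left (show (u : ℝ) ≤ b from hTb u hu) 1)) g.ceil
    (fun u _ => by
      have h1 : (u : ℝ) ≤ g.ceil u := g.le_ceil u
      rw [abs_of_nonneg (by linarith)]
      exact hg.ceil_sub_le u)
  refine (iInf_le _ lam).trans (max_le ?_ (iSup_le fun t => ?_))
  · refine iSup_le fun t => ?_
    rw [edist_dist, Subtype.dist_eq, Real.dist_eq]
    exact ENNReal.ofReal_le_ofReal ((hlamh t).trans (le_max_left _ _))
  rw [edist_dist]
  refine ENNReal.ofReal_le_ofReal (le_trans ?_ (le_max_right _ _))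
  change dist (x t) (x (g.floor (lam t))) ≤ _
  set s := g.floor (lam t) with hs
  have hsl : (s : ℝ) ≤ lam t := g.floor_le _
  have hlt := abs_le.1 (hlamh t)
  have hfl := hg.sub_floor_le (lam t)
  rw [← hs] at hfl
  -- No large jump `c` separates `t` from `s`: as `lam c` is the grid point `g.ceil c` and `s` is
  -- the grid floor of `lam t`, one has `c ≤ s` iff `lam c ≤ lam t` iff `c ≤ t`. The remaining jumps
  -- are at most `4 * η`, which gives `2 * η + 4 * η`.
  rcases le_total t s with hts | hst
  · refine (Cadlag.dist_le_of_jump_le hη (ζ := 4 * η) (by linarith) hx hts (by linarith)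
      fun c hc hcs => ?_).trans (by linarith)
    by_contra! hcT
    have h1 : lam c = g.ceil c := hlam c hcT
    have h2 : g.ceil c ≤ s := g.ceil_le (g.floor_mem _) hcs
    have h3 : lam t < lam c := lam.strictMono hc
    exact absurd (h3.trans_le (h1.trans_le h2)) (not_lt.2 hsl)
  · rw [dist_comm]
    refine (Cadlag.dist_le_of_jump_le hη (ζ := 4 * η) (by linarith) hx hst (by linarith)
      fun c hc hct => ?_).trans (by linarith)
    by_contra! hcT
    have h1 : lam c = g.ceil c := hlam c hcT
    have h2 : lam c ≤ lam t := lam.monotone hct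
    have h3 : g.ceil c ≤ s := g.le_floor (g.ceil_mem c) (h1 ▸ h2)
    exact absurd (hc.trans_le (g.le_ceil c)) (not_lt.2 h3)

theorem skorohodInf_step_step_le (g : Grid) (y z : g.pts → S) :
    Cadlag.skorohodInf Cadlag.unifSize (g.step y) (g.step z) ≤ edist y z :=
  (iInf_le _ (OrderIso.refl I)).trans <| max_le (by simp [Cadlag.isSize_unifSize.refl]) <|
    iSup_le fun t => edist_le_pi_edist y z ⟨g.floor t, g.floor_mem t⟩

end Grid

/-! ### A single path: convergence of its step approximations, rarity and stability of its jumps -/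

namespace Cadlag

variable {S : Type*} [MetricSpace S]

/-- Each time `c` has a neighbourhood in which `x` oscillates little on either side of `c`. A
Lebesgue number puts the triple in one such neighbourhood, and the middle time shares a side of `c`
with one of the outer two. -/
theorem exists_smallIncrements (x : Cadlag S) {η : ℝ} (hη : 0 < η) :
    ∃ δ > 0, SmallIncrements x δ η := by
  have key : ∀ t : I, ∃ U : Set I, IsOpen U ∧ t ∈ U ∧
      (∀ r ∈ U, ∀ s ∈ U, r < t → s < t → dist (x r) (x s) ≤ η) ∧
      (∀ r ∈ U, ∀ s ∈ U, t ≤ r → t ≤ s → dist (x r) (x s) ≤ η) := by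
    intro t
    have hl := (x.tendsto_leftLim t) (Metric.ball_mem_nhds _ (half_pos hη))
    have hr : Tendsto x (𝓝[≥] t) (𝓝 (x t)) := x.right_continuous' t
    have hr := hr (Metric.ball_mem_nhds _ (half_pos hη))
    obtain ⟨U, hU, htU, hUl⟩ := mem_nhdsWithin.1 (mem_map.1 hl)
    obtain ⟨V, hV, htV, hVr⟩ := mem_nhdsWithin.1 (mem_map.1 hr)
    refine ⟨U ∩ V, hU.inter hV, ⟨htU, htV⟩, fun r hr s hs hrt hst => ?_, fun r hr s hs hrt hst => ?_⟩
    · have h1 : dist _ _ < _ := hUl ⟨hr.1, hrt⟩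
      have h2 : dist _ _ < _ := hUl ⟨hs.1, hst⟩
      have := dist_triangle_right (x r) (x s) (Function.leftLim x t)
      linarith
    · have h1 : dist _ _ < _ := hVr ⟨hr.2, hrt⟩
      have h2 : dist _ _ < _ := hVr ⟨hs.2, hst⟩
      have := dist_triangle_right (x r) (x s) (x t)
      linarith
  choose U hU htU hUl hUr using key
  obtain ⟨δ, hδ, hb⟩ := lebesgue_number_lemma_of_metric (isCompact_univ (X := I)) hU
    (fun t _ => mem_iUnion.2 ⟨t, htU t⟩)
  refine ⟨δ / 2, half_pos hδ, fun r s t hrs hst htr => ?_⟩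
  obtain ⟨c, hc⟩ := hb r (mem_univ _)
  have hrs' : (r : ℝ) ≤ s := hrs
  have hst' : (s : ℝ) ≤ t := hst
  have hmem : ∀ u : I, r ≤ u → u ≤ t → u ∈ U c := by
    intro u hu hut
    have hu' : (r : ℝ) ≤ u := hu
    have hut' : (u : ℝ) ≤ t := hut
    refine hc ?_
    rw [Metric.mem_ball, Subtype.dist_eq, Real.dist_eq, abs_of_nonneg (by linarith)]
    linarith
  have hr := hmem r le_rfl (hrs.trans hst)
  have hs := hmem s hrs hst
  have ht := hmem t (hrs.trans hst) le_rfl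
  rcases lt_or_ge s c with h | h
  · exact min_le_of_left_le (hUl c r hr s hs (hrs.trans_lt h) h)
  · exact min_le_of_right_le (hUr c s hs t ht h (h.trans hst))

/-- The step approximations of a càdlàg function without jump at `1` converge to it. -/
theorem tendsto_skorohodInf_step {x : Cadlag S} (hx : Function.leftLim x 1 = x 1)
    {g : ℕ → Grid} {h : ℕ → ℝ} (h0 : ∀ j, 0 ≤ h j) (hg : ∀ j, (g j).Fine (h j))
    (hh : Tendsto h atTop (𝓝 0)) :
    Tendsto (fun j => skorohodInf unifSize ((g j).step fun q => x q) x) atTop (𝓝 0) := by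
  rw [ENNReal.tendsto_nhds_zero]
  intro ε hε
  obtain ⟨e, he, hee⟩ : ∃ e : ℝ, 0 < e ∧ ENNReal.ofReal e ≤ ε := by
    obtain ⟨e, he, hee⟩ := ENNReal.lt_iff_exists_nnreal_btwn.1 hε
    exact ⟨e, by simpa using he, by simpa using hee.le⟩
  obtain ⟨δ, hδ, hsm⟩ := x.exists_smallIncrements (η := e / 6) (by positivity)
  obtain ⟨a, ha0, haδ, hxa⟩ : ∃ a : I, 0 < a ∧ (a : ℝ) ≤ δ ∧ dist (x 0) (x a) ≤ e / 6 := by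
    have hr : Tendsto x (𝓝[>] 0) (𝓝 (x 0)) :=
      (x.right_continuous' 0).tendsto.mono_left (nhdsWithin_mono _ Ioi_subset_Ici_self)
    have hc : Tendsto (fun a : I => (a : ℝ)) (𝓝[>] 0) (𝓝 ((0 : I) : ℝ)) :=
      continuous_subtype_val.continuousAt.tendsto.mono_left nhdsWithin_le_nhds
    have hd := (tendsto_const_nhds (x := x 0)).dist hr
    rw [dist_self] at hd
    have : (𝓝[>] (0 : I)).NeBot := nhdsGT_neBot_of_exists_gt ⟨1, zero_lt_one⟩
    obtain ⟨a, ⟨h1, h2⟩, h3⟩ := ((hd.eventually_lt_const (by positivity : 0 < e / 6)).and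
      (hc.eventually_lt_const (by simpa using hδ)) |>.and self_mem_nhdsWithin).exists
    exact ⟨a, h3, h2.le, h1.le⟩
  obtain ⟨b, hb1, hbδ, hxb⟩ : ∃ b : I, b < 1 ∧ 1 - (b : ℝ) ≤ δ ∧ dist (x b) (x 1) ≤ e / 6 := by
    have hl := x.tendsto_dist_jump 1
    rw [jump, hx, dist_self] at hl
    have hc : Tendsto (fun b : I => (b : ℝ)) (𝓝[<] 1) (𝓝 ((1 : I) : ℝ)) :=
      continuous_subtype_val.continuousAt.tendsto.mono_left nhdsWithin_le_nhds
    have : (𝓝[<] (1 : I)).NeBot := nhdsLT_neBot_of_exists_lt ⟨0, zero_lt_one⟩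
    obtain ⟨b, ⟨h1, h2⟩, h3⟩ := ((hl.eventually_lt_const (by positivity : 0 < e / 6)).and
      (hc.eventually_const_lt (by simpa using hδ : 1 - δ < ((1 : I) : ℝ)))
      |>.and self_mem_nhdsWithin).exists
    exact ⟨b, h3, by linarith, h1.le⟩
  have ha0' : (0 : ℝ) < a := ha0
  have hb1' : (b : ℝ) < 1 := hb1
  filter_upwards [hh.eventually_lt_const he,
    hh.eventually_lt_const (by linarith : (0 : ℝ) < a / 4),
    hh.eventually_lt_const (by linarith : (0 : ℝ) < (1 - b) / 4)] with j h1 h2 h3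
  refine ((hg j).skorohodInf_step_le (h0 j) (by positivity) hsm haδ hbδ hxa hxb (by linarith)
    (by linarith)).trans (le_trans (ENNReal.ofReal_le_ofReal (max_le h1.le (by linarith))) hee)

/-- On each side of `t`, near `t`, the path stays close to a one-sided limit, so jumps there are
small. -/
theorem eventually_jump_lt (x : Cadlag S) (t : I) {ε : ℝ} (hε : 0 < ε) :
    ∀ᶠ s in 𝓝[≠] t, x.jump s < ε := by
  have aux : ∀ (l : S) (J : Set I), IsOpen J → (∀ᶠ s in 𝓝[J] t, dist (x s) l < ε / 3) →
      ∀ᶠ s in 𝓝[J] t, x.jump s < ε := by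
    intro l J hJ h
    filter_upwards [eventually_eventually_nhdsWithin.2 h, h, self_mem_nhdsWithin] with s hs hs' hsJ
    refine lt_of_le_of_lt (b := 2 * (ε / 3)) (jump_le_of_eventually (by positivity) ?_)
      (by linarith)
    rw [hJ.nhdsWithin_eq hsJ] at hs
    filter_upwards [nhdsWithin_le_nhds hs] with u hu
    have := dist_triangle_right (x u) (x s) l
    linarith
  rw [← Iio_union_Ioi, nhdsWithin_union, eventually_sup]
  have hr : Tendsto x (𝓝[>] t) (𝓝 (x t)) :=
    (x.right_continuous' t).tendsto.mono_left (nhdsWithin_mono _ Ioi_subset_Ici_self)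
  exact ⟨aux _ _ isOpen_Iio
      ((x.tendsto_leftLim t).eventually (Metric.ball_mem_nhds _ (by positivity))),
    aux _ _ isOpen_Ioi (hr.eventually (Metric.ball_mem_nhds _ (by positivity)))⟩

theorem finite_le_jump (x : Cadlag S) {ε : ℝ} (hε : 0 < ε) : {t | ε ≤ x.jump t}.Finite := by
  by_contra hinf
  obtain ⟨t, -, ht⟩ := Set.Infinite.exists_accPt_of_subset_isCompact hinf isCompact_univ
    (subset_univ _)
  rw [accPt_iff_frequently_nhdsNE] at ht
  exact ht ((x.eventually_jump_lt t hε).mono fun s hs => hs.not_ge)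

/-- A near-optimal time change carries the jump at `t` to a jump of `y` at `lam t`; each end of the
jump moves by at most `ρ`. -/
theorem jump_le_of_skorohodInf_lt {x y : Cadlag S} {t : I} {ρ : ℝ}
    (h : skorohodInf unifSize x y < ENNReal.ofReal ρ) :
    ∃ s, dist s t < ρ ∧ x.jump t ≤ y.jump s + 2 * ρ := by
  obtain ⟨lam, hl⟩ := iInf_lt_iff.1 h
  have h1 : ∀ s, dist (lam s) s < ρ := fun s => by
    have := (le_iSup (fun s : I => edist (lam s) s) s).trans_lt ((le_max_left _ _).trans_lt hl)
    rwa [edist_lt_ofReal] at this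
  have h2 : ∀ s, dist (x s) (y (lam s)) ≤ ρ := fun s => by
    have := (le_iSup (fun s : I => edist (x s) (y (lam s))) s).trans_lt
      ((le_max_right _ _).trans_lt hl)
    rw [edist_lt_ofReal] at this
    exact this.le
  refine ⟨lam t, h1 t, ?_⟩
  have hρ : 0 ≤ ρ := dist_nonneg.trans (h2 0)
  rcases eq_or_neBot (𝓝[<] t) with h' | h'
  · have : x.jump t = 0 := by simp [jump, leftLim_eq_of_eq_bot _ h']
    rw [this]
    have : 0 ≤ y.jump (lam t) := dist_nonneg
    positivity
  have hlt : Tendsto lam (𝓝[<] t) (𝓝[<] (lam t)) :=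
    tendsto_nhdsWithin_iff.2 ⟨lam.continuous.continuousAt.tendsto.mono_left nhdsWithin_le_nhds, by
      filter_upwards [self_mem_nhdsWithin] with s hs using lam.strictMono hs⟩
  refine le_of_tendsto_of_tendsto (x.tendsto_dist_jump t)
    (((y.tendsto_dist_jump (lam t)).comp hlt).add_const _) (Eventually.of_forall fun s => ?_)
  have := dist_triangle4_right (x s) (x t) (y (lam s)) (y (lam t))
  have := h2 s
  have := h2 t
  simp only [Function.comp]
  linarith

end Cadlag

/-! ### Dyadic chaining and the moment bound -/

/-- The dyadic time `i / 2 ^ k`. -/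
noncomputable def dyadicTime (k i : ℕ) : I := projIcc 0 1 zero_le_one ((i : ℝ) / 2 ^ k)

theorem coe_dyadicTime {k i : ℕ} (h : i ≤ 2 ^ k) : (dyadicTime k i : ℝ) = (i : ℝ) / 2 ^ k := by
  have h' : (i : ℝ) ≤ 2 ^ k := by exact_mod_cast h
  rw [dyadicTime, projIcc_of_mem zero_le_one
    (show (i : ℝ) / 2 ^ k ∈ Icc (0 : ℝ) 1 from ⟨by positivity, (div_le_one (by positivity)).2 h'⟩)]

theorem dyadicTime_mono (k : ℕ) : Monotone (dyadicTime k) := fun i j h =>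
  monotone_projIcc _ (by gcongr)

theorem dyadicTime_succ_two_mul (k i : ℕ) : dyadicTime (k + 1) (2 * i) = dyadicTime k i := by
  rw [dyadicTime, dyadicTime]
  congr 1
  push_cast
  rw [pow_succ']
  field_simp

section Chaining

variable {S : Type*} [MetricSpace S]

/-- Chaining along dyadic refinements: control of adjacent triples at all levels from `m` on gives
control of all triples in a window of level `m`. -/
theorem min_dist_le_of_dyadic {g : ℕ → ℕ → S} (hg : ∀ k i, g (k + 1) (2 * i) = g k i)
    {b : ℕ → ℝ} (hb : ∀ k, 0 ≤ b k) {m : ℕ}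
    (hB : ∀ k, m ≤ k → ∀ i, i + 2 ≤ 2 ^ k →
      min (dist (g k i) (g k (i + 1))) (dist (g k (i + 1)) (g k (i + 2))) ≤ b k) (n a : ℕ) :
    ∀ i₁ i₂ i₃, i₁ ≤ i₂ → i₂ ≤ i₃ → a * 2 ^ n ≤ i₁ → i₃ ≤ (a + 2) * 2 ^ n → i₃ ≤ 2 ^ (m + n) →
      min (dist (g (m + n) i₁) (g (m + n) i₂)) (dist (g (m + n) i₂) (g (m + n) i₃)) ≤
        2 * ∑ j ∈ Finset.range (n + 1), b (m + j) := by
  induction n with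
  | zero =>
    intro i₁ i₂ i₃ h12 h23 h1 h3 h3'
    simp only [pow_zero, mul_one, add_zero, zero_add, Finset.range_one, Finset.sum_singleton]
      at h1 h3 h3' ⊢
    have hbm := hb m
    rcases h12.eq_or_lt with rfl | h12
    · exact min_le_of_left_le (by simpa using hbm)
    rcases h23.eq_or_lt with rfl | h23
    · exact min_le_of_right_le (by simpa using hbm)
    obtain rfl : i₁ = a := by omega
    obtain rfl : i₂ = i₁ + 1 := by omega
    obtain rfl : i₃ = i₁ + 2 := by omega
    exact (hB m le_rfl i₁ h3').trans (by linarith)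
  | succ n ih =>
    -- An even index already lives on the coarser level. An odd one is the middle of an adjacent
    -- triple, so it can be rounded to whichever even neighbour has a close value.
    have hround : ∀ i, ∃ i', i ≤ 2 ^ (m + (n + 1)) →
        (i ≤ 2 * i' + 1 ∧ 2 * i' ≤ i + 1) ∧
          dist (g (m + (n + 1)) i) (g (m + n) i') ≤ b (m + (n + 1)) := by
      intro i
      by_cases hi : i ≤ 2 ^ (m + (n + 1))
      swap
      · exact ⟨0, fun h => absurd h hi⟩
      rcases Nat.even_or_odd' i with ⟨q, rfl | rfl⟩
      · exact ⟨q, fun _ => ⟨⟨by omega, by omega⟩, by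
          rw [← add_assoc, hg, dist_self]; exact hb _⟩⟩
      · have hp : 2 ^ (m + (n + 1)) = 2 * 2 ^ (m + n) := by rw [← add_assoc, pow_succ']
        have h := hB (m + (n + 1)) (by omega) (2 * q) (by omega)
        rcases min_le_iff.1 h with h | h
        · refine ⟨q, fun _ => ⟨⟨by omega, by omega⟩, ?_⟩⟩
          rw [dist_comm]
          rwa [← hg (m + n) q, add_assoc]
        · refine ⟨q + 1, fun _ => ⟨⟨by omega, by omega⟩, ?_⟩⟩
          rwa [← hg (m + n) (q + 1), add_assoc, show 2 * (q + 1) = 2 * q + 2 by ring]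
    choose R hR using hround
    intro i₁ i₂ i₃ h12 h23 h1 h3 h3'
    have hp : 2 ^ (m + (n + 1)) = 2 * 2 ^ (m + n) := by rw [← add_assoc, pow_succ']
    obtain ⟨⟨a1, a2⟩, a3⟩ := hR i₁ (by omega)
    obtain ⟨⟨b1, b2⟩, b3⟩ := hR i₂ (by omega)
    obtain ⟨⟨c1, c2⟩, c3⟩ := hR i₃ (by omega)
    -- Rounding moves an index by at most one, so it preserves strict order weakly; equal indices
    -- are rounded alike because `R` is a function.
    have m12 : R i₁ ≤ R i₂ := by
      rcases h12.eq_or_lt with rfl | h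
      · exact le_rfl
      · omega
    have m23 : R i₂ ≤ R i₃ := by
      rcases h23.eq_or_lt with rfl | h
      · exact le_rfl
      · omega
    have w1 : a * 2 ^ n ≤ R i₁ := by
      have : a * 2 ^ (n + 1) = 2 * (a * 2 ^ n) := by ring
      omega
    have w2 : R i₃ ≤ (a + 2) * 2 ^ n := by
      have : (a + 2) * 2 ^ (n + 1) = 2 * ((a + 2) * 2 ^ n) := by ring
      omega
    have key := ih (R i₁) (R i₂) (R i₃) m12 m23 w1 w2 (by omega)
    rw [Finset.sum_range_succ]
    set A := ∑ j ∈ Finset.range (n + 1), b (m + j)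
    rcases min_le_iff.1 key with h | h
    · refine min_le_of_left_le ?_
      have := dist_triangle4 (g (m + (n + 1)) i₁) (g (m + n) (R i₁)) (g (m + n) (R i₂))
        (g (m + (n + 1)) i₂)
      rw [dist_comm (g (m + n) (R i₂))] at this
      linarith
    · refine min_le_of_right_le ?_
      have := dist_triangle4 (g (m + (n + 1)) i₂) (g (m + n) (R i₂)) (g (m + n) (R i₃))
        (g (m + (n + 1)) i₃)
      rw [dist_comm (g (m + n) (R i₃))] at this
      linarith

/-- The dyadic time of level `k` next to the right of `t`. -/
noncomputable def dyadicCeil (k : ℕ) (t : I) : ℕ := ⌈(t : ℝ) * 2 ^ k⌉₊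

theorem dyadicCeil_le (k : ℕ) (t : I) : dyadicCeil k t ≤ 2 ^ k := by
  refine Nat.ceil_le.2 ?_
  push_cast
  exact mul_le_of_le_one_left (by positivity) t.2.2

theorem tendsto_dyadicTime_dyadicCeil (m : ℕ) (t : I) :
    Tendsto (fun n => dyadicTime (m + n) (dyadicCeil (m + n) t)) atTop (𝓝[≥] t) := by
  have hle : ∀ k, (t : ℝ) ≤ dyadicTime k (dyadicCeil k t) := fun k => by
    rw [coe_dyadicTime (dyadicCeil_le k t), le_div_iff₀ (by positivity)]
    exact Nat.le_ceil _
  have hge : ∀ k, (dyadicTime k (dyadicCeil k t) : ℝ) ≤ t + (1 / 2) ^ k := fun k => by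
    rw [coe_dyadicTime (dyadicCeil_le k t), div_le_iff₀ (by positivity), add_mul, ← mul_pow]
    norm_num
    exact (Nat.ceil_lt_add_one (mul_nonneg t.2.1 (by positivity))).le
  refine tendsto_nhdsWithin_iff.2 ⟨?_, Eventually.of_forall fun n => hle _⟩
  rw [tendsto_subtype_rng]
  refine tendsto_of_tendsto_of_tendsto_of_le_of_le tendsto_const_nhds ?_
    (fun n => hle (m + n)) (fun n => hge (m + n))
  have h1 : Tendsto (fun k : ℕ => (t : ℝ) + (1 / 2) ^ k) atTop (𝓝 (t + 0)) :=
    tendsto_const_nhds.add (tendsto_pow_atTop_nhds_zero_of_lt_one (by norm_num) (by norm_num))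
  rw [add_zero] at h1
  refine h1.comp (tendsto_atTop_mono (fun n => ?_) tendsto_id)
  exact Nat.le_add_left _ _

/-- Rounding times up to dyadic ones, right-continuity carries the chaining bound to all times; the
level errors `θ ^ k` sum geometrically. -/
theorem smallIncrements_of_dyadic {f : I → S} (hf : ∀ t, ContinuousWithinAt f (Ici t) t)
    {θ : ℝ} (hθ0 : 0 < θ) (hθ1 : θ < 1) {m : ℕ}
    (hB : ∀ k, m ≤ k → ∀ i, i + 2 ≤ 2 ^ k →
      min (dist (f (dyadicTime k i)) (f (dyadicTime k (i + 1))))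
        (dist (f (dyadicTime k (i + 1))) (f (dyadicTime k (i + 2)))) ≤ θ ^ k) :
    SmallIncrements f (1 / 2 ^ m) (2 * (θ ^ m / (1 - θ))) := by
  intro r s t hrs hst htr
  have hlim : ∀ u : I, Tendsto (fun n => f (dyadicTime (m + n) (dyadicCeil (m + n) u))) atTop
      (𝓝 (f u)) := fun u => (hf u).tendsto.comp (tendsto_dyadicTime_dyadicCeil m u)
  refine le_of_tendsto (((hlim r).dist (hlim s)).min ((hlim s).dist (hlim t)))
    (Eventually.of_forall fun n => ?_)
  have hmono : ∀ {u v : I}, u ≤ v → dyadicCeil (m + n) u ≤ dyadicCeil (m + n) v := by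
    intro u v huv
    refine Nat.ceil_mono (mul_le_mul_of_nonneg_right ?_ (by positivity))
    exact huv
  -- An interval of length `1 / 2 ^ m` can straddle a dyadic point, so it is covered by two
  -- consecutive cells of level `m`, starting at `a`.
  set a := ⌊(r : ℝ) * 2 ^ m⌋₊ with ha
  have ha1 : (a : ℝ) ≤ r * 2 ^ m := Nat.floor_le (mul_nonneg r.2.1 (by positivity))
  have ha2 : (r : ℝ) * 2 ^ m < a + 1 := Nat.lt_floor_add_one _
  have hw1 : a * 2 ^ n ≤ dyadicCeil (m + n) r := by
    have : ((a * 2 ^ n : ℕ) : ℝ) ≤ dyadicCeil (m + n) r := by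
      refine le_trans ?_ (Nat.le_ceil _)
      push_cast
      rw [pow_add, ← mul_assoc]
      gcongr
    exact_mod_cast this
  have hw2 : dyadicCeil (m + n) t ≤ (a + 2) * 2 ^ n := by
    refine Nat.ceil_le.2 ?_
    push_cast
    rw [pow_add, ← mul_assoc]
    gcongr
    have : ((t : ℝ) - r) * 2 ^ m ≤ 1 := by
      rwa [le_div_iff₀ (by positivity)] at htr
    linarith
  refine (min_dist_le_of_dyadic (g := fun k i => f (dyadicTime k i))
    (fun k i => by rw [dyadicTime_succ_two_mul]) (b := fun k => θ ^ k) (fun k => by positivity) hB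
    n a _ _ _ (hmono hrs) (hmono hst) hw1 hw2 (dyadicCeil_le _ _)).trans ?_
  gcongr
  simp only [pow_add]
  rw [← Finset.mul_sum, div_eq_mul_inv]
  gcongr
  have hs := summable_geometric_of_lt_one hθ0.le hθ1
  rw [← tsum_geometric_of_lt_one hθ0.le hθ1]
  exact hs.sum_le_tsum _ fun i _ => by positivity

end Chaining

/-- A monotone continuous function on `[0,1]` is, up to a factor, dominated by a homeomorphism. -/
theorem exists_orderIso_dominating {F : I → ℝ} (hFm : Monotone F) (hFc : Continuous F) :
    ∃ (G : I ≃o I) (M : ℝ), 0 ≤ M ∧ ∀ r t : I, r ≤ t → F t - F r ≤ M * ((G t : ℝ) - G r) := by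
  set M := F 1 - F 0 + 1 with hM
  have hM0 : 0 < M := by
    have := hFm (zero_le_one (α := I))
    linarith
  -- Adding the identity makes the clock strictly increasing even where `F` is flat.
  set L : I → ℝ := fun t => (F t - F 0 + t) / M with hL
  have hL0 : L 0 = 0 := by simp [hL]
  have hL1 : L 1 = 1 := by simp only [hL, Icc.coe_one]; exact div_self hM0.ne'
  have hLmono : StrictMono L := by
    intro s t hst
    have h1 : (s : ℝ) < t := hst
    have h2 := hFm hst.le
    exact div_lt_div_of_pos_right (by linarith) hM0
  have hLcont : Continuous L := by fun_prop
  obtain ⟨G, hG⟩ := exists_orderIso_of_strictMono hLmono hLcont hL0 hL1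
  refine ⟨G, M, hM0.le, fun r t hrt => ?_⟩
  rw [hG, hG]
  have h1 : (r : ℝ) ≤ t := hrt
  simp only [hL]
  rw [← sub_div, mul_div_cancel₀ _ hM0.ne']
  linarith

/-- The quotient is the growth factor of the failure probability from one dyadic level to the next.
At `θ = 1` it equals `2 ^ (1 - 2α) < 1`, and it is continuous there. -/
theorem exists_chaining_ratio {α β : ℝ} (hα : 1 / 2 < α) :
    ∃ θ : ℝ, 0 < θ ∧ θ < 1 ∧ 2 * (1 / 2 : ℝ) ^ (2 * α) / θ ^ (4 * β) < 1 := by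
  have h1 : 2 * (1 / 2 : ℝ) ^ (2 * α) < 1 := by
    have := Real.rpow_lt_rpow_of_exponent_gt (x := 1 / 2) (by norm_num) (by norm_num)
      (by linarith : 1 < 2 * α)
    rw [Real.rpow_one] at this
    linarith
  have h2 : Tendsto (fun θ : ℝ => θ ^ (4 * β)) (𝓝[<] 1) (𝓝 1) := by
    have := (Real.continuousAt_rpow_const 1 (4 * β) (Or.inl one_ne_zero)).tendsto
    rw [Real.one_rpow] at this
    exact this.mono_left nhdsWithin_le_nhds
  obtain ⟨θ, hθ, hθ'⟩ := ((h2.eventually_const_lt h1).and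
    (Ioo_mem_nhdsLT (zero_lt_one (α := ℝ)))).exists
  exact ⟨θ, hθ'.1, hθ'.2, (div_lt_one (Real.rpow_pos_of_pos hθ'.1 _)).2 hθ⟩

/-- A moment bound on the smaller of two successive increments controls the increments of càdlàg
processes uniformly. -/
theorem exists_smallIncrements_of_moment_bound {S Ω ι : Type*} [MetricSpace S] [MeasurableSpace Ω]
    (P : Measure Ω) [IsFiniteMeasure P] (Y : ι → Ω → Cadlag S) {α β : ℝ} (hα : 1 / 2 < α)
    {F : I → ℝ} (hFm : Monotone F) (hFc : Continuous F)
    (hF : ∀ r s t : I, r ≤ s → s ≤ t → ∀ l : ℝ, 0 < l → ∀ n,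
      P.real {ω | l ≤ min (dist (Y n ω r) (Y n ω s)) (dist (Y n ω s) (Y n ω t))} ≤
        1 / l ^ (4 * β) * (F t - F r) ^ (2 * α))
    {η : ℝ} (hη : 0 < η) {ε : ℝ≥0∞} (hε : 0 < ε) :
    ∃ δ > 0, ∀ n, ∃ E : Set Ω, P E ≤ ε ∧ ∀ ω ∉ E, SmallIncrements (Y n ω) δ η := by
  obtain ⟨G, M, hM, hG⟩ := exists_orderIso_dominating hFm hFc
  obtain ⟨θ, hθ0, hθ1, hq1⟩ := exists_chaining_ratio (β := β) hα
  set q := 2 * (1 / 2 : ℝ) ^ (2 * α) / θ ^ (4 * β) with hq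
  have hq0 : 0 ≤ q := by positivity
  set C := (2 * M) ^ (2 * α) with hC
  have hC0 : 0 ≤ C := Real.rpow_nonneg (by positivity) _
  have hlim1 : Tendsto (fun m : ℕ => 2 * (θ ^ m / (1 - θ))) atTop (𝓝 0) := by
    have := ((tendsto_pow_atTop_nhds_zero_of_lt_one hθ0.le hθ1).div_const (1 - θ)).const_mul 2
    simpa using this
  have hlim2 : Tendsto (fun m : ℕ => ENNReal.ofReal (C * q ^ m * (1 - q)⁻¹)) atTop (𝓝 0) := by
    have := ((tendsto_pow_atTop_nhds_zero_of_lt_one hq0 hq1).const_mul C).mul_const (1 - q)⁻¹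
    rw [mul_zero, zero_mul] at this
    simpa using ENNReal.tendsto_ofReal this
  -- The starting level serves twice: it makes the chaining error at most `η` and the total failure
  -- probability of all later levels at most `ε`.
  obtain ⟨m, hm1, hm2⟩ := ((hlim1.eventually_lt_const hη).and
    (hlim2.eventually_lt_const hε)).exists
  obtain ⟨δ, hδ, hGδ⟩ := Metric.uniformContinuous_iff.1
    (CompactSpace.uniformContinuous_of_continuous G.continuous) (1 / 2 ^ m) (by positivity)
  let bad : ι → ℕ → ℕ → Set Ω := fun n k i => {ω | θ ^ k ≤
    min (dist (Y n ω (G.symm (dyadicTime k i))) (Y n ω (G.symm (dyadicTime k (i + 1)))))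
      (dist (Y n ω (G.symm (dyadicTime k (i + 1)))) (Y n ω (G.symm (dyadicTime k (i + 2)))))}
  have hbad : ∀ n k i, i + 2 ≤ 2 ^ k →
      P.real (bad n k i) ≤ 1 / (θ ^ k) ^ (4 * β) * (M * (2 / 2 ^ k)) ^ (2 * α) := by
    intro n k i hi
    have mono := G.symm.monotone.comp (dyadicTime_mono k)
    refine (hF _ _ _ (mono (Nat.le_succ i)) (mono (Nat.le_succ (i + 1))) (θ ^ k) (by positivity)
      n).trans ?_
    have hle := mono (show i ≤ i + 2 by omega)
    have h0 := hFm hle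
    have h1 := hG _ _ hle
    simp only [Function.comp, OrderIso.apply_symm_apply] at h0 h1
    rw [coe_dyadicTime hi, coe_dyadicTime (by omega : i ≤ 2 ^ k), ← sub_div] at h1
    push_cast at h1
    rw [add_sub_cancel_left] at h1
    exact mul_le_mul_of_nonneg_left (Real.rpow_le_rpow (sub_nonneg.2 h0) h1 (by linarith))
      (by positivity)
  have hlevel : ∀ n k, P (⋃ i ∈ Finset.range (2 ^ k - 1), bad n k i) ≤
      ENNReal.ofReal (C * q ^ k) := by
    intro n k
    rw [← ofReal_measureReal (measure_ne_top P _)]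
    refine ENNReal.ofReal_le_ofReal ((measureReal_biUnion_finset_le _ _).trans ?_)
    have hp : 0 < 2 ^ k := by positivity
    refine (Finset.sum_le_card_nsmul _ _ _ fun i hi => hbad n k i (by
      have := Finset.mem_range.1 hi
      omega)).trans ?_
    rw [Finset.card_range, nsmul_eq_mul]
    have hle : ((2 ^ k - 1 : ℕ) : ℝ) ≤ 2 ^ k := by
      exact_mod_cast Nat.sub_le _ _
    have e1 : M * (2 / 2 ^ k) = 2 * M * (1 / 2) ^ k := by
      rw [div_pow, one_pow]; ring
    have e2 : 1 / (θ ^ k) ^ (4 * β) * (M * (2 / 2 ^ k)) ^ (2 * α) =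
        C * (((1 / 2 : ℝ) ^ (2 * α)) ^ k / (θ ^ (4 * β)) ^ k) := by
      rw [e1, Real.mul_rpow (by positivity) (by positivity), ← Real.rpow_pow_comm hθ0.le,
        ← Real.rpow_pow_comm (by norm_num : (0 : ℝ) ≤ 1 / 2)]
      ring
    rw [e2]
    calc ((2 ^ k - 1 : ℕ) : ℝ) * (C * (((1 / 2 : ℝ) ^ (2 * α)) ^ k / (θ ^ (4 * β)) ^ k))
        ≤ 2 ^ k * (C * (((1 / 2 : ℝ) ^ (2 * α)) ^ k / (θ ^ (4 * β)) ^ k)) := by gcongr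
      _ = C * q ^ k := by
        rw [hq, div_pow, mul_pow]; ring
  refine ⟨δ / 2, half_pos hδ, fun n =>
    ⟨⋃ j : ℕ, ⋃ i ∈ Finset.range (2 ^ (m + j) - 1), bad n (m + j) i, ?_, fun ω hω => ?_⟩⟩
  · refine (measure_iUnion_le _).trans ((ENNReal.tsum_le_tsum fun j => hlevel n (m + j)).trans ?_)
    refine le_trans (le_of_eq ?_) hm2.le
    have hs := summable_geometric_of_lt_one hq0 hq1
    simp only [pow_add, ← mul_assoc]
    rw [← ENNReal.ofReal_tsum_of_nonneg (fun j => by positivity) (hs.mul_left _), tsum_mul_left,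
      tsum_geometric_of_lt_one hq0 hq1]
  · have hsm : SmallIncrements (fun t => Y n ω (G.symm t)) (1 / 2 ^ m) (2 * (θ ^ m / (1 - θ))) := by
      refine smallIncrements_of_dyadic (fun t => ?_) hθ0 hθ1 fun k hk i hi => ?_
      · exact ((Y n ω).right_continuous' (G.symm t)).comp
          G.symm.continuous.continuousWithinAt fun s hs => G.symm.monotone hs
      · by_contra! hlt
        refine hω (mem_iUnion.2 ⟨k - m, ?_⟩)
        rw [Nat.add_sub_cancel' hk]
        exact mem_iUnion₂.2 ⟨i, Finset.mem_range.2 (by omega), hlt.le⟩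
    intro r s t hrs hst htr
    have hrt : (r : ℝ) ≤ t := hrs.trans hst
    have hd : dist (G t) (G r) < 1 / 2 ^ m := hGδ (by
      rw [Subtype.dist_eq, Real.dist_eq, abs_of_nonneg (by linarith)]
      linarith)
    rw [Subtype.dist_eq, Real.dist_eq] at hd
    have := hsm (G r) (G s) (G t) (G.monotone hrs) (G.monotone hst)
      ((le_abs_self _).trans hd.le)
    simp only [OrderIso.symm_apply_apply] at this
    exact this.trans hm1.le

/-! ### Convergence in distribution through approximating sequences -/

section Approximation

variable {Ω E : Type*} [MeasurableSpace Ω] {P : Measure Ω} [IsProbabilityMeasure P]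
  [MetricSpace E] [MeasurableSpace E] [BorelSpace E]

/-- Use the Lipschitz bound where the distance is below `e` and the oscillation bound elsewhere.
Without separability of `E` the exceptional set may fail to be measurable, so it is replaced by a
measurable hull of the same measure. -/
theorem abs_integral_comp_sub_le {f : E → ℝ} {L : NNReal} (hf : LipschitzWith L f) {C : ℝ}
    (hC : ∀ x y, dist (f x) (f y) ≤ C) {A B : Ω → E} (hA : AEMeasurable A P)
    (hB : AEMeasurable B P) {e : ℝ} (he : 0 ≤ e) :
    |∫ ω, f (A ω) ∂P - ∫ ω, f (B ω) ∂P| ≤ L * e + C * P.real {ω | e ≤ dist (A ω) (B ω)} := by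
  obtain ⟨ω₀⟩ := nonempty_of_isProbabilityMeasure P
  have hC0 : 0 ≤ C := dist_nonneg.trans (hC (A ω₀) (A ω₀))
  have hfm : Measurable f := hf.continuous.measurable
  have hint : ∀ {D : Ω → E}, AEMeasurable D P → Integrable (fun ω => f (D ω)) P := by
    intro D hD
    refine Integrable.of_bound (hfm.comp_aemeasurable hD).aestronglyMeasurable
      (C + |f (A ω₀)|) (Eventually.of_forall fun ω => ?_)
    have h1 := hC (D ω) (A ω₀)
    rw [Real.dist_eq] at h1
    have h2 := abs_sub_abs_le_abs_sub (f (D ω)) (f (A ω₀))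
    rw [Real.norm_eq_abs]
    linarith
  set N := toMeasurable P {ω | e ≤ dist (A ω) (B ω)} with hN
  have hNm : MeasurableSet N := measurableSet_toMeasurable _ _
  have hNi : Integrable (N.indicator fun _ => C) P := (integrable_const C).indicator hNm
  rw [← integral_sub (hint hA) (hint hB), ← Real.norm_eq_abs]
  refine (norm_integral_le_integral_norm _).trans ?_
  have hmono : ∫ ω, ‖f (A ω) - f (B ω)‖ ∂P ≤ ∫ ω, (L * e + N.indicator (fun _ => C) ω) ∂P := by
    refine integral_mono ((hint hA).sub (hint hB)).norm ((integrable_const _).add hNi) fun ω => ?_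
    change ‖f (A ω) - f (B ω)‖ ≤ L * e + N.indicator (fun _ => C) ω
    rw [← dist_eq_norm]
    rcases lt_or_ge (dist (A ω) (B ω)) e with h | h
    · have h1 : dist (f (A ω)) (f (B ω)) ≤ L * e :=
        (hf.dist_le_mul _ _).trans (mul_le_mul_of_nonneg_left h.le L.2)
      have h2 : 0 ≤ N.indicator (fun _ => C) ω := indicator_nonneg (fun _ _ => hC0) _
      linarith
    · have hω : ω ∈ N := subset_toMeasurable P _ h
      rw [indicator_of_mem hω]
      have := hC (A ω) (B ω)
      have : 0 ≤ (L : ℝ) * e := by positivity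
      linarith
  refine hmono.trans (le_of_eq ?_)
  rw [integral_add (integrable_const _) hNi, integral_const, integral_indicator_const _ hNm,
    probReal_univ, one_smul, smul_eq_mul, mul_comm C, measureReal_def, hN,
    measure_toMeasurable, ← measureReal_def]

theorem MeasureTheory.TendstoInDistribution.tendsto_integral_comp {Y : ℕ → Ω → E} {Z : Ω → E}
    (h : TendstoInDistribution Y atTop Z (fun _ => P) P) {f : E → ℝ}
    (hb : ∃ C : ℝ, ∀ x y, dist (f x) (f y) ≤ C) (hL : ∃ L, LipschitzWith L f) :
    Tendsto (fun n => ∫ ω, f (Y n ω) ∂P) atTop (𝓝 (∫ ω, f (Z ω) ∂P)) := by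
  have hf : Measurable f := hL.choose_spec.continuous.measurable
  have := tendsto_iff_forall_lipschitz_integral_tendsto.1 h.tendsto f hb hL
  simp only [ProbabilityMeasure.coe_mk] at this
  rw [integral_map h.aemeasurable_limit hf.aestronglyMeasurable] at this
  refine this.congr fun n => ?_
  exact integral_map (h.forall_aemeasurable n) hf.aestronglyMeasurable

/-- A sequence that is approximated, uniformly in the limit, by sequences converging in
distribution, converges in distribution. -/
theorem tendstoInDistribution_of_approx {X : ℕ → Ω → E} {Z : Ω → E} {Y : ℕ → ℕ → Ω → E}
    {W : ℕ → Ω → E} (hX : ∀ n, AEMeasurable (X n) P) (hZ : AEMeasurable Z P)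
    (hYW : ∀ j, TendstoInDistribution (Y j) atTop (W j) (fun _ => P) P)
    (hW : ∀ᵐ ω ∂P, Tendsto (fun j => W j ω) atTop (𝓝 (Z ω)))
    (hYX : ∀ e c : ℝ, 0 < e → 0 < c → ∀ᶠ j in atTop, ∀ᶠ n in atTop,
      P.real {ω | e ≤ dist (Y j n ω) (X n ω)} ≤ c) :
    TendstoInDistribution X atTop Z (fun _ => P) P := by
  refine ⟨hX, hZ, tendsto_iff_forall_lipschitz_integral_tendsto.2 ?_⟩
  rintro f ⟨C, hC⟩ ⟨L, hL⟩
  have hfm : Measurable f := hL.continuous.measurable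
  obtain ⟨ω₀⟩ := nonempty_of_isProbabilityMeasure P
  have hC0 : 0 ≤ C := dist_nonneg.trans (hC (Z ω₀) (Z ω₀))
  suffices Tendsto (fun n => ∫ ω, f (X n ω) ∂P) atTop (𝓝 (∫ ω, f (Z ω) ∂P)) by
    simp only [ProbabilityMeasure.coe_mk]
    rw [integral_map hZ hfm.aestronglyMeasurable]
    refine this.congr fun n => ?_
    exact (integral_map (hX n) hfm.aestronglyMeasurable).symm
  have hWZ := (tendstoInDistribution_of_ae_tendsto (fun j => (hYW j).aemeasurable_limit) hZ
    hW).tendsto_integral_comp ⟨C, hC⟩ ⟨L, hL⟩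
  rw [Metric.tendsto_nhds]
  intro ε hε
  have hL0 : (0 : ℝ) ≤ L := L.2
  obtain ⟨j, hj1, hj2⟩ := ((Metric.tendsto_nhds.1 hWZ (ε / 4) (by positivity)).and
    (hYX (ε / (4 * (L + 1))) (ε / (4 * (C + 1))) (by positivity) (by positivity))).exists
  filter_upwards [hj2, Metric.tendsto_nhds.1
    ((hYW j).tendsto_integral_comp ⟨C, hC⟩ ⟨L, hL⟩) (ε / 4) (by positivity)] with n hn1 hn2
  have h1 := abs_integral_comp_sub_le hL hC ((hYW j).forall_aemeasurable n) (hX n)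
    (e := ε / (4 * (L + 1))) (by positivity)
  have h2 : (L : ℝ) * (ε / (4 * (L + 1))) ≤ ε / 4 := by
    rw [mul_div_assoc', div_le_div_iff₀ (by positivity) (by positivity)]
    nlinarith
  have h3 : C * P.real {ω | ε / (4 * (L + 1)) ≤ dist (Y j n ω) (X n ω)} ≤ ε / 4 := by
    refine (mul_le_mul_of_nonneg_left hn1 hC0).trans ?_
    rw [mul_div_assoc', div_le_div_iff₀ (by positivity) (by positivity)]
    nlinarith
  rw [← Real.dist_eq] at h1
  have h4 := dist_triangle4 (∫ ω, f (X n ω) ∂P) (∫ ω, f (Y j n ω) ∂P) (∫ ω, f (W j ω) ∂P)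
    (∫ ω, f (Z ω) ∂P)
  rw [dist_comm (∫ ω, f (X n ω) ∂P) (∫ ω, f (Y j n ω) ∂P)] at h4
  linarith

end Approximation

theorem ConvInDistr.continuous_comp {Ω S E : Type*} [MeasurableSpace Ω] {P : Measure Ω}
    [IsProbabilityMeasure P] [TopologicalSpace S] [TopologicalSpace E] [MeasurableSpace E]
    [BorelSpace E] {Y : ℕ → Ω → S} {Z : Ω → S} (h : ConvInDistr P Y Z) {g : S → E}
    (hg : Continuous g) :
    TendstoInDistribution (fun n => g ∘ Y n) atTop (g ∘ Z) (fun _ => P) P :=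
  letI : MeasurableSpace S := borel S
  haveI : BorelSpace S := ⟨rfl⟩
  TendstoInDistribution.continuous_comp hg h

/-! ### Fixed times of discontinuity -/

/-- Infinitely many events of probability at least `c` would have a limsup of probability at least
`c`, yet no point lies in infinitely many of them. -/
theorem finite_setOf_le_measure {Ω ι : Type*} [MeasurableSpace Ω] (P : Measure Ω)
    [IsFiniteMeasure P] {A : ι → Set Ω} (hA : ∀ i, MeasurableSet (A i))
    (hfin : ∀ ω, {i | ω ∈ A i}.Finite) {c : ℝ≥0∞} (hc : 0 < c) : {i | c ≤ P (A i)}.Finite := by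
  by_contra hinf
  have hinf : {i | c ≤ P (A i)}.Infinite := hinf
  let t := hinf.natEmbedding
  let B : ℕ → Set Ω := fun n => ⋃ m ≥ n, A (t m)
  have hB : Antitone B := fun n n' h =>
    iUnion_mono fun m => iUnion_mono' fun hm => ⟨h.trans hm, le_rfl⟩
  have hlim := tendsto_measure_iInter_atTop (μ := P)
    (fun n => (MeasurableSet.iUnion fun m => MeasurableSet.iUnion fun _ =>
      hA (t m)).nullMeasurableSet) hB ⟨0, measure_ne_top _ _⟩
  have hempty : ⋂ n, B n = ∅ := by
    refine eq_empty_of_forall_notMem fun ω hω => ?_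
    have hinj : Function.Injective fun m => (t m : ι) :=
      Subtype.val_injective.comp t.injective
    have hf : {m | ω ∈ A (t m)}.Finite := (hfin ω).preimage hinj.injOn
    obtain ⟨N, hN⟩ := hf.bddAbove
    obtain ⟨m, hm, hωm⟩ := mem_iUnion₂.1 (mem_iInter.1 hω (N + 1))
    have := hN hωm
    have : N + 1 ≤ m := hm
    omega
  rw [hempty, measure_empty] at hlim
  refine hc.not_ge (ge_of_tendsto' hlim fun n => ?_)
  exact (t n).2.trans (measure_mono (subset_iUnion₂_of_subset n le_rfl subset_rfl))

theorem DDSpace.edist_eq (x y : DDSpace) :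
    edist x y = Cadlag.skorohodInf (S := DSpace) Cadlag.unifSize x y := rfl

/-- The jump at a fixed time is upper semicontinuous: the jump at `t` of a nearby path is matched
with a jump of `y` close to `t`, and all of those are below `ε'`. This supplies the measurability of
jump events. -/
theorem DDSpace.isClosed_setOf_le_jump (t : I) (ε : ℝ) :
    IsClosed {x : DDSpace | ε ≤ Cadlag.jump (S := DSpace) x t} := by
  rw [← isOpen_compl_iff, Metric.isOpen_iff]
  intro y hy
  have hy : Cadlag.jump (S := DSpace) y t < ε := not_le.1 hy
  have hy0 : 0 ≤ Cadlag.jump (S := DSpace) y t := dist_nonneg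
  set ε' := (Cadlag.jump (S := DSpace) y t + ε) / 2 with hε'
  have hev : ∀ᶠ s in 𝓝 t, Cadlag.jump (S := DSpace) y s < ε' := by
    have h1 := Cadlag.eventually_jump_lt (S := DSpace) y t (ε := ε') (by linarith)
    rw [eventually_nhdsWithin_iff] at h1
    filter_upwards [h1] with s hs
    by_cases hst : s = t
    · rw [hst]; linarith
    · exact hs hst
  obtain ⟨ρ, hρ, hball⟩ := Metric.eventually_nhds_iff.1 hev
  refine ⟨min ρ ((ε - ε') / 2), lt_min hρ (by linarith), fun x hx => ?_⟩
  have hx' : edist x y < ENNReal.ofReal (min ρ ((ε - ε') / 2)) := edist_lt_ofReal.2 hx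
  rw [DDSpace.edist_eq] at hx'
  obtain ⟨s, hs1, hs2⟩ := Cadlag.jump_le_of_skorohodInf_lt (t := t) hx'
  have h1 := hball (hs1.trans_le (min_le_left _ _))
  have h2 := min_le_right ρ ((ε - ε') / 2)
  exact (show Cadlag.jump (S := DSpace) x t < ε by linarith).not_ge

section Times

variable {Ω : Type*} [MeasurableSpace Ω] {P : Measure Ω} {X : Ω → DDSpace}

/-- A path has finitely many jumps of size at least `1 / (k + 1)`, so only finitely many times carry
such a jump with probability at least `1 / (m + 1)`. The exceptional times are the union over `k`
and `m`. -/
theorem countable_compl_fixedContinuityTimes [IsFiniteMeasure P] (hX : Measurable X) :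
    (fixedContinuityTimes P X)ᶜ.Countable := by
  let A : ℕ → I → Set Ω := fun k t =>
    {ω | 1 / ((k : ℝ) + 1) ≤ Cadlag.jump (S := DSpace) (X ω) t}
  have hA : ∀ k t, MeasurableSet (A k t) := fun k t =>
    hX (DDSpace.isClosed_setOf_le_jump t _).measurableSet
  have hfin : ∀ k m : ℕ, {t | ((m : ℝ≥0∞) + 1)⁻¹ ≤ P (A k t)}.Finite := fun k m =>
    finite_setOf_le_measure P (hA k)
      (fun ω => Cadlag.finite_le_jump (S := DSpace) (X ω) (ε := 1 / ((k : ℝ) + 1))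
        (by positivity)) (by simp)
  refine (countable_iUnion fun k => countable_iUnion fun m => (hfin k m).countable).mono ?_
  intro t ht
  by_contra hcon
  simp only [mem_iUnion, mem_ofPred_eq, not_exists, not_le] at hcon
  refine ht ?_
  have hzero : ∀ k, P (A k t) = 0 := by
    intro k
    by_contra hne
    obtain ⟨m, hm⟩ := ENNReal.exists_inv_nat_lt hne
    refine (hcon k m).not_gt (lt_of_le_of_lt ?_ hm)
    exact ENNReal.inv_le_inv.2 le_self_add
  have hae : ∀ᵐ ω ∂P, ∀ k, ω ∉ A k t := ae_all_iff.2 fun k => measure_eq_zero_iff_ae_notMem.1 (hzero k)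
  filter_upwards [hae] with ω hω
  by_contra hne
  have hpos : 0 < Cadlag.jump (S := DSpace) (X ω) t := dist_pos.2 (Ne.symm hne)
  obtain ⟨k, hk⟩ := exists_nat_one_div_lt hpos
  exact hω k hk.le

theorem exists_mem_fixedContinuityTimes [IsFiniteMeasure P] (hX : Measurable X) {u v : I} (huv : u < v) :
    ∃ t ∈ fixedContinuityTimes P X, u < t ∧ t < v := by
  have hd := ((countable_compl_fixedContinuityTimes (P := P) hX).image
    (Subtype.val : I → ℝ)).dense_compl ℝ
  obtain ⟨t, ht, hut, htv⟩ := hd.exists_between (show (u : ℝ) < v from huv)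
  refine ⟨⟨t, u.2.1.trans hut.le, htv.le.trans v.2.2⟩, ?_, hut, htv⟩
  by_contra hcon
  exact ht ⟨_, hcon, rfl⟩

theorem zero_mem_fixedContinuityTimes : (0 : I) ∈ fixedContinuityTimes P X :=
  ae_of_all P fun _ => (leftLim_eq_of_isBot fun _ => unitInterval.nonneg').symm

/-- Along a sequence the convergence in probability is almost sure, and the limit of the distances
is also the distance from `X(1)` to its left limit. -/
theorem one_mem_fixedContinuityTimes
    (hb : TendstoInMeasure P (fun (δ : I) ω => dist (X ω 1) (X ω (σ δ))) (𝓝[>] 0) (fun _ => 0)) :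
    (1 : I) ∈ fixedContinuityTimes P X := by
  have : (𝓝[>] (0 : I)).NeBot := nhdsGT_neBot_of_exists_gt ⟨1, zero_lt_one⟩
  have : (𝓝[<] (1 : I)).NeBot := nhdsLT_neBot_of_exists_lt ⟨0, zero_lt_one⟩
  obtain ⟨d, hd, hae⟩ := hb.exists_seq_tendsto_ae'
  have hσ : Tendsto (fun i => σ (d i)) atTop (𝓝[<] 1) := by
    refine Tendsto.comp (g := σ) (tendsto_nhdsWithin_iff.2 ⟨?_, ?_⟩) hd
    · have := (continuous_symm.tendsto (0 : I)).mono_left (nhdsWithin_le_nhds (s := Ioi 0))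
      rwa [symm_zero] at this
    · filter_upwards [self_mem_nhdsWithin] with s hs
      simpa using symm_lt_symm.2 hs
  filter_upwards [hae] with ω hω
  have h1 := ((Cadlag.tendsto_leftLim (S := DSpace) (X ω) 1).comp hσ)
  have h2 := (tendsto_const_nhds (x := X ω 1)).dist h1
  exact dist_eq_zero.1 (tendsto_nhds_unique h2 hω)

end Times

/-! ### Grids of continuity times, and passage to the limit on them -/

/-- Around every `c` choose `p ≤ c ≤ q` in `T`, within `h / 2` of `c`, with `[p, q]` a neighbourhood
of `c`. A finite subcover by such intervals provides the grid points. -/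
theorem exists_grid {T : Set I} (h0 : 0 ∈ T) (h1 : 1 ∈ T)
    (hT : ∀ u v : I, u < v → ∃ t ∈ T, u < t ∧ t < v) {h : ℝ} (hh : 0 < h) :
    ∃ g : Grid, (∀ q ∈ g.pts, q ∈ T) ∧ g.Fine h := by
  classical
  have hp : ∀ c : I, ∃ p ∈ T, Ici p ∈ 𝓝 c ∧ (c : ℝ) - p ≤ h / 2 := by
    intro c
    rcases (unitInterval.nonneg' (t := c)).eq_or_lt with rfl | hc
    · exact ⟨0, h0, Filter.mem_of_superset univ_mem fun t _ => unitInterval.nonneg',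
        by simpa using (half_pos hh).le⟩
    · have hlim : Tendsto (fun s : I => (c : ℝ) - s) (𝓝[<] c) (𝓝 ((c : ℝ) - c)) :=
        (by fun_prop : Continuous fun s : I => (c : ℝ) - s).continuousAt.tendsto.mono_left
          nhdsWithin_le_nhds
      rw [sub_self] at hlim
      have : (𝓝[<] c).NeBot := nhdsLT_neBot_of_exists_lt ⟨0, hc⟩
      obtain ⟨u, hu, huc⟩ := ((hlim.eventually_lt_const (half_pos hh)).and
        self_mem_nhdsWithin).exists
      obtain ⟨p, hpT, hup, hpc⟩ := hT u c huc
      have hup' : (u : ℝ) < p := hup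
      exact ⟨p, hpT, Ici_mem_nhds hpc, by linarith⟩
  have hq : ∀ c : I, ∃ q ∈ T, Iic q ∈ 𝓝 c ∧ (q : ℝ) - c ≤ h / 2 := by
    intro c
    rcases (unitInterval.le_one' (t := c)).eq_or_lt with rfl | hc
    · exact ⟨1, h1, Filter.mem_of_superset univ_mem fun t _ => unitInterval.le_one',
        by simpa using (half_pos hh).le⟩
    · have hlim : Tendsto (fun s : I => (s : ℝ) - c) (𝓝[>] c) (𝓝 ((c : ℝ) - c)) :=
        (by fun_prop : Continuous fun s : I => (s : ℝ) - c).continuousAt.tendsto.mono_left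
          nhdsWithin_le_nhds
      rw [sub_self] at hlim
      have : (𝓝[>] c).NeBot := nhdsGT_neBot_of_exists_gt ⟨1, hc⟩
      obtain ⟨u, hu, huc⟩ := ((hlim.eventually_lt_const (half_pos hh)).and
        self_mem_nhdsWithin).exists
      obtain ⟨q, hqT, hcq, hqu⟩ := hT c u huc
      have hqu' : (q : ℝ) < u := hqu
      exact ⟨q, hqT, Iic_mem_nhds hcq, by linarith⟩
  choose p hpT hpn hph using hp
  choose q hqT hqn hqh using hq
  obtain ⟨C, -, hC⟩ := isCompact_univ.elim_nhds_subcover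
    (fun c => Ici (p c) ∩ Iic (q c)) fun c _ => inter_mem (hpn c) (hqn c)
  refine ⟨⟨insert 0 (insert 1 (C.image p ∪ C.image q)), by simp, by simp⟩, ?_, fun t => ?_⟩
  · intro x hx
    simp only [Finset.mem_insert, Finset.mem_union, Finset.mem_image] at hx
    rcases hx with rfl | rfl | ⟨c, -, rfl⟩ | ⟨c, -, rfl⟩
    · exact h0
    · exact h1
    · exact hpT c
    · exact hqT c
  · obtain ⟨c, hcC, hpt, htq⟩ := mem_iUnion₂.1 (hC (mem_univ t))
    have hpt' : (p c : ℝ) ≤ t := hpt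
    have htq' : (t : ℝ) ≤ q c := htq
    have := hph c
    have := hqh c
    refine ⟨⟨p c, ?_, hpt, by linarith⟩, q c, ?_, htq, by linarith⟩
    · simp only [Finset.mem_insert, Finset.mem_union, Finset.mem_image]
      exact Or.inr (Or.inr (Or.inl ⟨c, hcC, rfl⟩))
    · simp only [Finset.mem_insert, Finset.mem_union, Finset.mem_image]
      exact Or.inr (Or.inr (Or.inr ⟨c, hcC, rfl⟩))

namespace Grid

/-- The step function through given values, as an element of `𝔻([0,1];𝔻)`. -/
noncomputable def stepDD (g : Grid) (y : g.pts → DSpace) : DDSpace := g.step y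

theorem edist_stepDD_le (g : Grid) (y z : g.pts → DSpace) :
    edist (g.stepDD y) (g.stepDD z) ≤ edist y z := by
  rw [DDSpace.edist_eq]
  exact g.skorohodInf_step_step_le y z

theorem continuous_stepDD (g : Grid) : Continuous g.stepDD :=
  LipschitzWith.continuous (K := 1) fun y z => by simpa using g.edist_stepDD_le y z

end Grid

section FiniteDimensional

variable {Ω : Type*} [MeasurableSpace Ω] {P : Measure Ω} [IsProbabilityMeasure P]
  {Xn : ℕ → Ω → DDSpace} {X : Ω → DDSpace} {T : Set I}

theorem tendstoInDistribution_stepDD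
    (ha : ∀ (k : ℕ) (t : Fin k → I), (∀ i, t i ∈ T) →
      ConvInDistr P (fun n ω (i : Fin k) => Xn n ω (t i)) (fun ω (i : Fin k) => X ω (t i)))
    (g : Grid) (hg : ∀ q ∈ g.pts, q ∈ T) :
    TendstoInDistribution (fun n ω => g.stepDD fun q => Xn n ω q) atTop
      (fun ω => g.stepDD fun q => X ω q) (fun _ => P) P := by
  let e := Fintype.equivFin g.pts
  have h := (ha _ (fun i => (e.symm i : I)) fun i => hg _ (e.symm i).2).continuous_comp
    (g := fun y => g.stepDD fun q => y (e q))
    (g.continuous_stepDD.comp (continuous_pi fun q => continuous_apply (e q)))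
  simpa [Function.comp_def] using h

theorem tendstoInDistribution_dist
    (ha : ∀ (k : ℕ) (t : Fin k → I), (∀ i, t i ∈ T) →
      ConvInDistr P (fun n ω (i : Fin k) => Xn n ω (t i)) (fun ω (i : Fin k) => X ω (t i)))
    {s t : I} (hs : s ∈ T) (ht : t ∈ T) :
    TendstoInDistribution (fun n ω => dist (Xn n ω s) (Xn n ω t)) atTop
      (fun ω => dist (X ω s) (X ω t)) (fun _ => P) P := by
  have h := (ha 2 ![s, t] fun i => by fin_cases i <;> assumption).continuous_comp
    (g := fun y => dist (y 0) (y 1)) (by fun_prop)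
  simpa [Function.comp_def] using h

/-- Portmanteau for a closed half-line: this hands the smallness of the increments at the end points
from `X` to `X_n`. -/
theorem MeasureTheory.TendstoInDistribution.eventually_measure_le_lt {Y : ℕ → Ω → ℝ} {Z : Ω → ℝ}
    (h : TendstoInDistribution Y atTop Z (fun _ => P) P) {η : ℝ} {c : ℝ≥0∞}
    (hc : P {ω | η ≤ Z ω} < c) : ∀ᶠ n in atTop, P {ω | η ≤ Y n ω} < c := by
  have hl := ProbabilityMeasure.limsup_measure_closed_le_of_tendsto h.tendsto
    (isClosed_Ici (a := η))
  simp only [ProbabilityMeasure.coe_mk] at hl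
  rw [Measure.map_apply_of_aemeasurable h.aemeasurable_limit measurableSet_Ici] at hl
  filter_upwards [eventually_lt_of_limsup_lt (hl.trans_lt hc)] with n hn
  rwa [Measure.map_apply_of_aemeasurable (h.forall_aemeasurable n) measurableSet_Ici] at hn

end FiniteDimensional

/-! ### The convergence theorem -/

theorem mainTheorem11 {Ω : Type*} [MeasurableSpace Ω] (P : Measure Ω) [IsProbabilityMeasure P]
    (Xn : ℕ → Ω → DDSpace) (X : Ω → DDSpace)
    (hXn : ∀ n, Measurable (Xn n)) (hX : Measurable X)
    -- a) convergence of the finite-dimensional distributions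
    (ha : ∀ (k : ℕ) (t : Fin k → I), (∀ i, t i ∈ fixedContinuityTimes P X) →
      ConvInDistr P (fun n ω (i : Fin k) => Xn n ω (t i)) (fun ω (i : Fin k) => X ω (t i)))
    -- b) continuity in probability of the limit at time `1`
    (hb : TendstoInMeasure P (fun (δ : I) ω => dist (X ω 1) (X ω (σ δ))) (𝓝[>] 0) (fun _ => 0))
    -- c) control of the moduli in the space variable
    (hc₁ : ∀ ε : ℝ, 0 < ε → Tendsto
      (fun δ : I => limsup (fun n => P {ω | ∃ t : I, ε ≤ wSecond (Xn n ω t) δ}) atTop)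
      (𝓝[>] 0) (𝓝 0))
    (hc₂ : ∀ ε : ℝ, 0 < ε → Tendsto
      (fun δ : I => limsup (fun n => P {ω | ∃ t : I, ε ≤ |Xn n ω t δ - Xn n ω t 0|}) atTop)
      (𝓝[>] 0) (𝓝 0))
    (hc₃ : ∀ ε : ℝ, 0 < ε → Tendsto
      (fun δ : I => limsup (fun n => P {ω | ∃ t : I,
        ε ≤ |Function.leftLim (Xn n ω t) 1 - Xn n ω t (σ δ)|}) atTop)
      (𝓝[>] 0) (𝓝 0))
    (α β : ℝ) (hα : 1 / 2 < α) (hβ : 0 ≤ β)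
    (F : I → ℝ) (hFmono : Monotone F) (hFcont : Continuous F)
    -- the bound on the increments, uniform in `n`
    (hF : ∀ r s t : I, r ≤ s → s ≤ t → ∀ l : ℝ, 0 < l → ∀ n,
      P.real {ω | l ≤ min (dist (Xn n ω r) (Xn n ω s)) (dist (Xn n ω s) (Xn n ω t))} ≤
        1 / l ^ (4 * β) * (F t - F r) ^ (2 * α)) :
    ConvInDistr P Xn X := by
  set T := fixedContinuityTimes P X with hT
  have h0T : (0 : I) ∈ T := zero_mem_fixedContinuityTimes
  have h1T : (1 : I) ∈ T := one_mem_fixedContinuityTimes hb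
  have hdense : ∀ u v : I, u < v → ∃ t ∈ T, u < t ∧ t < v := fun u v huv =>
    exists_mem_fixedContinuityTimes hX huv
  have hgrid : ∀ j : ℕ, ∃ g : Grid, (∀ q ∈ g.pts, q ∈ T) ∧ g.Fine (1 / ((j : ℝ) + 1)) :=
    fun j => exists_grid h0T h1T hdense (by positivity)
  choose g hgT hg using hgrid
  have hmesh := tendsto_one_div_add_atTop_nhds_zero_nat (𝕜 := ℝ)
  refine tendstoInDistribution_of_approx (fun n => (hXn n).aemeasurable) hX.aemeasurable
    (fun j => tendstoInDistribution_stepDD ha (g j) (hgT j)) ?_ fun e c he hc => ?_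
  · have h1 : ∀ᵐ ω ∂P, X ω 1 = Function.leftLim (X ω) 1 := h1T
    filter_upwards [h1] with ω hω
    rw [tendsto_iff_edist_tendsto_0]
    exact Cadlag.tendsto_skorohodInf_step (S := DSpace) hω.symm (fun j => by positivity) hg hmesh
  -- Three exceptional events share the probability `c`: failure of small increments, a large
  -- increment from `0` to `a`, and one from `b` to `1`. With `η = e / 12` the deterministic bound
  -- `6 * η` is `e / 2`.
  set c' := ENNReal.ofReal (c / 3) with hc'
  have hc'0 : 0 < c' := by simpa [hc'] using hc
  set η := e / 12 with hη
  have hη0 : 0 < η := by positivity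
  obtain ⟨δ, hδ, hsm⟩ := exists_smallIncrements_of_moment_bound P (S := DSpace) Xn hα hFmono hFcont
    hF hη0 hc'0
  obtain ⟨a, haT, ha0, haδ, hPa⟩ : ∃ a ∈ T, 0 < a ∧ (a : ℝ) ≤ δ ∧
      P {ω | η ≤ dist (X ω 0) (X ω a)} < c' := by
    have : (𝓝[>] (0 : I)).NeBot := nhdsGT_neBot_of_exists_gt ⟨1, zero_lt_one⟩
    obtain ⟨u, hu⟩ := exists_seq_tendsto (𝓝[>] (0 : I))
    rw [tendsto_nhdsWithin_iff] at hu
    have hseq : ∀ i, ∃ t ∈ T, 0 < t ∧ ((0 : I) < u i → t < u i) := by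
      intro i
      by_cases hi : 0 < u i
      · obtain ⟨t, htT, h1, h2⟩ := hdense 0 (u i) hi
        exact ⟨t, htT, h1, fun _ => h2⟩
      · exact ⟨1, h1T, zero_lt_one, fun h => absurd h hi⟩
    choose v hvT hv0 hvu using hseq
    have hv : Tendsto v atTop (𝓝 0) := by
      refine tendsto_of_tendsto_of_tendsto_of_le_of_le' tendsto_const_nhds hu.1
        (Eventually.of_forall fun i => (hv0 i).le) ?_
      filter_upwards [hu.2] with i hi using (hvu i hi).le
    have hmeas : TendstoInMeasure P (fun i ω => dist (X ω 0) (X ω (v i))) atTop fun _ => 0 := by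
      -- Right-continuity of the paths at `0` gives the limit; measurability of the distances is
      -- contained in the convergence in distribution derived from a).
      refine tendstoInMeasure_of_tendsto_ae (fun i =>
        (tendstoInDistribution_dist ha h0T (hvT i)).aemeasurable_limit.aestronglyMeasurable)
        (ae_of_all P fun ω => ?_)
      have h1 : Tendsto (fun i => X ω (v i)) atTop (𝓝 (X ω 0)) :=
        ((Cadlag.right_continuous' (X ω) 0).tendsto).comp
          (tendsto_nhdsWithin_iff.2 ⟨hv, Eventually.of_forall fun i => (hv0 i).le⟩)
      simpa using (tendsto_const_nhds (x := X ω 0)).dist h1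
    rw [tendstoInMeasure_iff_dist] at hmeas
    have hvc : Tendsto (fun i => (v i : ℝ)) atTop (𝓝 ((0 : I) : ℝ)) :=
      (continuous_subtype_val.tendsto 0).comp hv
    obtain ⟨i, hi1, hi2⟩ := (((hmeas η hη0).eventually_lt_const hc'0).and
      (hvc.eventually_lt_const (by simpa using hδ))).exists
    exact ⟨v i, hvT i, hv0 i, hi2.le, by simpa [abs_of_nonneg dist_nonneg] using hi1⟩
  obtain ⟨b, hbT, hb1, hbδ, hPb⟩ : ∃ b ∈ T, b < 1 ∧ 1 - (b : ℝ) ≤ δ ∧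
      P {ω | η ≤ dist (X ω b) (X ω 1)} < c' := by
    rw [tendstoInMeasure_iff_dist] at hb
    have hcont : Tendsto (fun s : I => (s : ℝ)) (𝓝[>] 0) (𝓝 ((0 : I) : ℝ)) :=
      continuous_subtype_val.continuousAt.tendsto.mono_left nhdsWithin_le_nhds
    have hev := ((hb η hη0).eventually_lt_const hc'0).and
      (hcont.eventually_lt_const (by simpa using hδ : ((0 : I) : ℝ) < δ))
    -- Hypothesis b) is good on a whole interval `(0, u)`, so `1 - δ` can be moved to a time of `T`
    -- by density.
    obtain ⟨u, hu0, hu⟩ := (mem_nhdsGT_iff_exists_Ioo_subset' (zero_lt_one (α := I))).1 hev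
    obtain ⟨b, hbT, hub, hb1⟩ := hdense (σ u) 1 (by
      have := symm_lt_symm.2 (show (0 : I) < u from hu0)
      rwa [symm_zero] at this)
    have hσ : σ b ∈ Ioo 0 u := by
      constructor
      · have := symm_lt_symm.2 hb1
        rwa [symm_one] at this
      · have := symm_lt_symm.2 hub
        rwa [symm_symm] at this
    obtain ⟨h1, h2⟩ := hu hσ
    refine ⟨b, hbT, hb1, ?_, ?_⟩
    · rw [coe_symm_eq] at h2
      exact h2.le
    · simpa [abs_of_nonneg dist_nonneg, dist_comm] using h1
  have ha0' : (0 : ℝ) < a := ha0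
  have hb1' : (b : ℝ) < 1 := hb1
  filter_upwards [hmesh.eventually_lt_const (by linarith : (0 : ℝ) < e / 2),
    hmesh.eventually_lt_const (by linarith : (0 : ℝ) < a / 4),
    hmesh.eventually_lt_const (by linarith : (0 : ℝ) < (1 - b) / 4)] with j h1 h2 h3
  filter_upwards [(tendstoInDistribution_dist ha h0T haT).eventually_measure_le_lt hPa,
    (tendstoInDistribution_dist ha hbT h1T).eventually_measure_le_lt hPb] with n hn1 hn2
  obtain ⟨E, hE, hEsm⟩ := hsm n
  have hsub : {ω | e ≤ dist ((g j).stepDD fun q => Xn n ω q) (Xn n ω)} ⊆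
      E ∪ {ω | η ≤ dist (Xn n ω 0) (Xn n ω a)} ∪ {ω | η ≤ dist (Xn n ω b) (Xn n ω 1)} := by
    intro ω hω
    by_contra hcon
    simp only [mem_union, mem_ofPred_eq, not_or, not_le] at hcon
    obtain ⟨⟨k1, k2⟩, k3⟩ := hcon
    have key := (hg j).skorohodInf_step_le (S := DSpace) (by positivity) hη0.le (hEsm ω k1) haδ hbδ
      k2.le k3.le (by linarith) (by linarith)
    have hlt : edist ((g j).stepDD fun q => Xn n ω q) (Xn n ω) < ENNReal.ofReal e := by
      rw [DDSpace.edist_eq]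
      exact key.trans_lt ((ENNReal.ofReal_lt_ofReal_iff he).2 (max_lt (by linarith) (by linarith)))
    exact (edist_lt_ofReal.1 hlt).not_ge hω
  rw [measureReal_def]
  refine ENNReal.toReal_le_of_le_ofReal hc.le ?_
  calc P {ω | e ≤ dist ((g j).stepDD fun q => Xn n ω q) (Xn n ω)}
      ≤ c' + c' + c' := (measure_mono hsub).trans <| (measure_union_le _ _).trans <|
        add_le_add ((measure_union_le _ _).trans (add_le_add hE hn1.le)) hn2.le
    _ = ENNReal.ofReal c := by
      rw [hc', ← ENNReal.ofReal_add (by positivity) (by positivity),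
        ← ENNReal.ofReal_add (by positivity) (by positivity)]
      congr 1
      ring
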